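/- Let $a\in\mathbb{R}$, $q>0$, $r_1,r_2\ge 0$, $\sigma_0\ge 0$ and $0\le\sigma_{v1}\le\sigma_{v2}$. Let $x[0]\sim\mathcal N(0,\sigma_0^2)$, $w[n]\sim\mathcal N(0,1)$, $v_1[n]\sim\mathcal N(0,\sigma_{v1}^2)$, $v_2[n]\sim\mathcal N(0,\sigma_{v2}^2)$ ($n=0,1,2,\dots$) be mutually independent real random variables. Consider the scalar system with two controllers $$x[n+1]=a\,x[n]+u_1[n]+u_2[n]+w[n],\qquad y_i[n]=x[n]+v_i[n]\quad(i=1,2),$$ where the inputs are causal functions of each controller's own observations, $u_i[n]=f_{i,n}(y_i[0],\dots,y_i[n])$ with $f_{i,n}$ measurable. The average cost of a pair of strategies is $$J(u_1,u_2)=\limsup_{N\to\infty}\frac1N\sum_{0\le n<N}\mathbb{E}\big[q\,x^2[n]+r_1u_1^2[n]+r_2u_2^2[n]\big]\in[0,\infty].$$ Let $L_{lin,bb}$ be the set of the following two strategy pairs: (i) $u_1[n]=-a\,y_1[n]$, $u_2[n]=0$; (ii) $u_1[n]=0$, $u_2[n]=-a\,y_2[n]$. There is a constant $c\le 1200$ such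 that for all such $a,q,r_1,r_2,\sigma_0,\sigma_{v1},\sigma_{v2}$ with $|a|\ge 2.5$ and $\sigma_{v2}^2\le\max(1,a^2\sigma_{v1}^2)$ one has $0<\inf_{u_1,u_2}J(u_1,u_2)<\infty$ and $$\frac{\displaystyle\inf_{(u_1,u_2)\in L_{lin,bb}}J(u_1,u_2)}{\displaystyle\inf_{u_1,u_2}J(u_1,u_2)}\le c,$$ where the infimum in the denominator is over all causal measurable strategies. -/

import Mathlib

open MeasureTheory ProbabilityTheory Filter
open scoped ENNReal NNReal

/-- A causal measurable control law: at time `n` the input is a measurable function of the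
controller's own observations `y[0], …, y[n]`. -/
structure Controller where
  /-- the map `(y[0], …, y[n]) ↦ u[n]` -/
  law : (n : ℕ) → (Fin (n + 1) → ℝ) → ℝ
  measurable_law : ∀ n, Measurable (law n)

/-- The controller that always applies the input `0`. -/
def Controller.zero : Controller where
  law _ _ := 0
  measurable_law _ := measurable_const

/-- The memoryless linear controller `u[n] = -a y[n]`, which zero-forces the state. -/
def Controller.zeroForcing (a : ℝ) : Controller where
  law n y := -a * y (Fin.last n)
  measurable_law n := by fun_prop

/-- The set of the two strategy pairs in which one controller zero-forces the state and the
other one is silent. -/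
def linBB (a : ℝ) : Set (Controller × Controller) :=
  {(Controller.zeroForcing a, Controller.zero), (Controller.zero, Controller.zeroForcing a)}

/-- The state `x[n]` of the closed loop
`x[n+1] = a x[n] + u₁[n] + u₂[n] + w[n]`, `yᵢ[n] = x[n] + vᵢ[n]`,
for given realizations `x0, w, v₁, v₂` of the initial state and of the noises. -/
noncomputable def state (a : ℝ) (f₁ f₂ : Controller) (x0 : ℝ) (w v₁ v₂ : ℕ → ℝ) : ℕ → ℝ
  | 0 => x0
  | n + 1 =>
      a * state a f₁ f₂ x0 w v₁ v₂ n
        + f₁.law n (fun i : Fin (n + 1) => state a f₁ f₂ x0 w v₁ v₂ i.1 + v₁ i.1)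
        + f₂.law n (fun i : Fin (n + 1) => state a f₁ f₂ x0 w v₁ v₂ i.1 + v₂ i.1)
        + w n
  termination_by n => n
  decreasing_by
    · exact Nat.lt_succ_self n
    · exact i.2
    · exact i.2

/-- The input `u[n]` that the controller `f` applies when the state sequence is `x` and its
observation noise is `v`. -/
def controlInput (f : Controller) (x v : ℕ → ℝ) (n : ℕ) : ℝ :=
  f.law n (fun i : Fin (n + 1) => x i.1 + v i.1)

theorem state_zero (a : ℝ) (f₁ f₂ : Controller) (x0 : ℝ) (w v₁ v₂ : ℕ → ℝ) :
    state a f₁ f₂ x0 w v₁ v₂ 0 = x0 := by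
  rw [state]

theorem state_succ (a : ℝ) (f₁ f₂ : Controller) (x0 : ℝ) (w v₁ v₂ : ℕ → ℝ) (n : ℕ) :
    state a f₁ f₂ x0 w v₁ v₂ (n + 1) =
      a * state a f₁ f₂ x0 w v₁ v₂ n
        + controlInput f₁ (state a f₁ f₂ x0 w v₁ v₂) v₁ n
        + controlInput f₂ (state a f₁ f₂ x0 w v₁ v₂) v₂ n
        + w n := by
  rw [state]; rfl

/-- Labels of the underlying random variables `x[0]`, `w[n]`, `v₁[n]`, `v₂[n]`. -/
inductive NoiseIndex where
  | init : NoiseIndex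
  | dist (n : ℕ) : NoiseIndex
  | obs₁ (n : ℕ) : NoiseIndex
  | obs₂ (n : ℕ) : NoiseIndex

/-- The underlying random variables as one family. -/
def noiseFamily {Ω : Type*} (x0 : Ω → ℝ) (w v₁ v₂ : ℕ → Ω → ℝ) : NoiseIndex → Ω → ℝ
  | .init => x0
  | .dist n => w n
  | .obs₁ n => v₁ n
  | .obs₂ n => v₂ n

/-- The underlying random variables are mutually independent, `x[0] ∼ 𝒩(0, σ₀²)`,
`w[n] ∼ 𝒩(0, 1)`, `v₁[n] ∼ 𝒩(0, σ₁²)` and `v₂[n] ∼ 𝒩(0, σ₂²)`. -/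
structure IsGaussianNoise {Ω : Type*} [MeasurableSpace Ω] (P : Measure Ω)
    (σ₀ σ₁ σ₂ : ℝ≥0) (x0 : Ω → ℝ) (w v₁ v₂ : ℕ → Ω → ℝ) : Prop where
  law_init : HasLaw x0 (gaussianReal 0 (σ₀ ^ 2)) P
  law_dist : ∀ n, HasLaw (w n) (gaussianReal 0 1) P
  law_obs₁ : ∀ n, HasLaw (v₁ n) (gaussianReal 0 (σ₁ ^ 2)) P
  law_obs₂ : ∀ n, HasLaw (v₂ n) (gaussianReal 0 (σ₂ ^ 2)) P
  indep : iIndepFun (noiseFamily x0 w v₁ v₂) P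

/-- The quadratic cost `q x[n]² + r₁ u₁[n]² + r₂ u₂[n]²` at time `n`, for given realizations. -/
noncomputable def stageCost (a : ℝ) (q r₁ r₂ : ℝ≥0) (f₁ f₂ : Controller)
    (x0 : ℝ) (w v₁ v₂ : ℕ → ℝ) (n : ℕ) : ℝ :=
  q * state a f₁ f₂ x0 w v₁ v₂ n ^ 2
    + r₁ * controlInput f₁ (state a f₁ f₂ x0 w v₁ v₂) v₁ n ^ 2
    + r₂ * controlInput f₂ (state a f₁ f₂ x0 w v₁ v₂) v₂ n ^ 2

/-- The average cost
`limsup_{N → ∞} (1/N) ∑_{0 ≤ n < N} 𝔼[q x[n]² + r₁ u₁[n]² + r₂ u₂[n]²] ∈ [0, ∞]`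
of the strategy pair `(f₁, f₂)`. -/
noncomputable def avgCost {Ω : Type*} [MeasurableSpace Ω] (P : Measure Ω)
    (x0 : Ω → ℝ) (w v₁ v₂ : ℕ → Ω → ℝ) (a : ℝ) (q r₁ r₂ : ℝ≥0)
    (f₁ f₂ : Controller) : ℝ≥0∞ :=
  limsup (fun N : ℕ =>
    (∑ n ∈ Finset.range N, ∫⁻ ω, ENNReal.ofReal
      (stageCost a q r₁ r₂ f₁ f₂ (x0 ω) (fun k => w k ω) (fun k => v₁ k ω)
        (fun k => v₂ k ω) n) ∂P) / (N : ℝ≥0∞)) atTop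

/-- The optimal average cost over all causal measurable strategies. -/
noncomputable def optCost {Ω : Type*} [MeasurableSpace Ω] (P : Measure Ω)
    (x0 : Ω → ℝ) (w v₁ v₂ : ℕ → Ω → ℝ) (a : ℝ) (q r₁ r₂ : ℝ≥0) : ℝ≥0∞ :=
  ⨅ f : Controller × Controller, avgCost P x0 w v₁ v₂ a q r₁ r₂ f.1 f.2

/-- The optimal average cost over the two zero-forcing linear strategies. -/
noncomputable def linCost {Ω : Type*} [MeasurableSpace Ω] (P : Measure Ω)
    (x0 : Ω → ℝ) (w v₁ v₂ : ℕ → Ω → ℝ) (a : ℝ) (q r₁ r₂ : ℝ≥0) : ℝ≥0∞ :=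
  ⨅ f ∈ linBB a, avgCost P x0 w v₁ v₂ a q r₁ r₂ f.1 f.2

/-!
Write `T = max 1 (a ^ 2 * σ₁ ^ 2)`. Up to constants, zero-forcing by the first controller costs
`q T + r₁ a ^ 2 T`, and zero-forcing by the second one costs
`q (a ^ 2 * σ₂ ^ 2 + 1) + r₂ a ^ 2 (a ^ 2 * σ₂ ^ 2 + 1)`. For arbitrary control laws it is shown
that the average powers satisfy one of two alternatives: either `𝔼 x²` is of order `T` and
`𝔼 u₁²` is of order `a ^ 2 T`, or `𝔼 x²` is of order `a ^ 2 * σ₂ ^ 2 + 1` and `𝔼 u₂²` is of order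
`a ^ 2 (a ^ 2 * σ₂ ^ 2 + 1)`. In each case the cost is within a constant factor of one of the two
zero-forcing costs (`le_avgCost`).

Nonlinear control laws are handled through a decomposition that they cannot influence. If both
controllers pooled all observations made before time `n`, the error of their best estimate of
`x[n]` would be the prediction error of the centralized Kalman filter (`filterError`): a fixed
linear combination `ξ` of the underlying Gaussian variables, whatever the control laws are, and
independent of everything known to the controllers before time `n`. The Riccati recursion shows
that its variance `p` is eventually at least `2 / 5 * T` (`eventually_le_errorVar`), which bounds
`𝔼 x²` from below (`errorVar_le_integral_sq`).

The central estimate is `young_residualVar₂_le`. Let `Z` be the part of `ξ` that is uncorrelated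
with the current innovation `ξ + v₂`; its variance is `e = p σ₂² / (p + σ₂²)`. By Gaussianity `Z`
is independent of the past and of `u₂[n]`, and `u₁[n]` is correlated with `Z` only through
`ξ + v₁`. So `𝔼 (x[n+1] Z) = a e + e / (p + σ₁²) * 𝔼 (u₁[n] (ξ + v₁))`, and Cauchy–Schwarz forces
`𝔼 x[n+1]²` to be of order `a ^ 2 e` unless `𝔼 u₁[n]²` is of order `a ^ 2 p`. The hypothesis
`σ₂² ≤ T` makes `e` comparable with `σ₂²`. This is the only place where nonlinear signalling
between the controllers could matter. The power of `u₂` is then bounded from below because an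
unstable state must be compensated by the inputs (`sq_mul_integral_sq_le`).

The alternative is obtained for sums over long windows (`sum_dichotomy`). The window lengths are
chosen such that the boundary term `𝔼 x[N]²` is negligible, which is possible along a subsequence
when the average cost is finite (`ne_top_and_frequently_le_of_limsup_average_lt_top`).
-/

/-! ### Linear combinations of independent Gaussian variables -/

section GaussianSpace

variable {Ω ι : Type*} {N : ι → Ω → ℝ} {s : ι → ℝ≥0}

/-- The random variable `∑ i, c i • N i` with the finitely supported coefficients `c`. -/
noncomputable def noiseComb (N : ι → Ω → ℝ) : (ι →₀ ℝ) →ₗ[ℝ] (Ω → ℝ) :=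
  Finsupp.linearCombination ℝ N

/-- The bilinear form `∑ i, s i * c i * d i` on coefficient vectors: the covariance of
`noiseComb N c` and `noiseComb N d` when the `N i` are uncorrelated with variances `s i`. -/
noncomputable def covForm (s : ι → ℝ≥0) : (ι →₀ ℝ) →ₗ[ℝ] (ι →₀ ℝ) →ₗ[ℝ] ℝ :=
  Finsupp.linearCombination ℝ fun i => (s i : ℝ) • Finsupp.lapply i

theorem covForm_single_left (i : ι) (d : ι →₀ ℝ) :
    covForm s (Finsupp.single i 1) d = s i * d i := by
  simp [covForm]

theorem covForm_single_right (c : ι →₀ ℝ) (i : ι) :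
    covForm s c (Finsupp.single i 1) = s i * c i := by
  induction c using Finsupp.induction_linear with
  | zero => simp
  | add c d hc hd => simp [hc, hd, mul_add]
  | single j r =>
    classical
    simp only [covForm, Finsupp.linearCombination_single, LinearMap.smul_apply,
      Finsupp.lapply_apply, smul_eq_mul, Finsupp.single_apply]
    by_cases h : i = j
    · subst h; simp; ring
    · simp [h, Ne.symm h]

theorem covForm_comm (c d : ι →₀ ℝ) : covForm s c d = covForm s d c := by
  induction c using Finsupp.induction_linear with
  | zero => simp
  | add c e hc he => simp [hc, he]
  | single j r =>
    have h : Finsupp.single j r = r • Finsupp.single j (1 : ℝ) := by simp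
    rw [h, map_smul, map_smul, LinearMap.smul_apply, covForm_single_left, covForm_single_right]

theorem noiseComb_single (i : ι) (ω : Ω) : noiseComb N (Finsupp.single i 1) ω = N i ω := by
  simp [noiseComb]

theorem noiseComb_add (c d : ι →₀ ℝ) (ω : Ω) :
    noiseComb N (c + d) ω = noiseComb N c ω + noiseComb N d ω := by
  simp

theorem noiseComb_sub (c d : ι →₀ ℝ) (ω : Ω) :
    noiseComb N (c - d) ω = noiseComb N c ω - noiseComb N d ω := by
  simp

theorem noiseComb_smul (r : ℝ) (d : ι →₀ ℝ) (ω : Ω) :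
    noiseComb N (r • d) ω = r * noiseComb N d ω := by
  simp

/-- The σ-algebra generated by all linear combinations of the noises that are uncorrelated with
`noiseComb N z`. -/
@[reducible]
noncomputable def orthSigma (N : ι → Ω → ℝ) (s : ι → ℝ≥0) (z : ι →₀ ℝ) : MeasurableSpace Ω :=
  MeasurableSpace.comap
    (fun ω (d : {d : ι →₀ ℝ // covForm s z d = 0}) => noiseComb N d.1 ω) MeasurableSpace.pi

theorem measurable_orthSigma {z d : ι →₀ ℝ} (hd : covForm s z d = 0) :
    Measurable[orthSigma N s z] (noiseComb N d) := by
  have h1 : Measurable[orthSigma N s z]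
      (fun ω (d : {d : ι →₀ ℝ // covForm s z d = 0}) => noiseComb N d.1 ω) :=
    comap_measurable _
  exact (measurable_pi_apply (⟨d, hd⟩ : {d : ι →₀ ℝ // covForm s z d = 0})).comp h1

variable [MeasurableSpace Ω] {P : Measure Ω}

/-- The variables `N i` are independent centred Gaussians with variances `s i`. -/
structure IsIndepGaussian (N : ι → Ω → ℝ) (s : ι → ℝ≥0) (P : Measure Ω) : Prop where
  law : ∀ i, HasLaw (N i) (gaussianReal 0 (s i)) P
  indep : iIndepFun N P

namespace IsIndepGaussian

theorem jointlyGaussian (h : IsIndepGaussian N s P) :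
    IsGaussianProcess (fun c => noiseComb N c) P := by
  have hN : IsGaussianProcess N P :=
    ⟨fun I => iIndepFun.hasGaussianLaw (fun i => (h.law i).hasGaussianLaw)
      (h.indep.precomp Subtype.val_injective)⟩
  refine hN.of_isGaussianProcess fun c => ⟨c.support,
    { toFun := fun x => ∑ i, c i.1 * x i
      map_add' := fun x y => by simp [mul_add, Finset.sum_add_distrib]
      map_smul' := fun r x => by
        simp only [Pi.smul_apply, smul_eq_mul, RingHom.id_apply, Finset.mul_sum]
        exact Finset.sum_congr rfl fun i _ => by ring
      cont := by fun_prop }, fun ω => ?_⟩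
  simp [noiseComb, Finsupp.linearCombination_apply, Finsupp.sum,
    ← Finset.sum_coe_sort c.support]

theorem memLp (h : IsIndepGaussian N s P) (c : ι →₀ ℝ) : MemLp (noiseComb N c) 2 P :=
  (h.jointlyGaussian.hasGaussianLaw_eval c).memLp_two

theorem memLp_noise (h : IsIndepGaussian N s P) (i : ι) : MemLp (N i) 2 P :=
  (h.law i).hasGaussianLaw.memLp_two

theorem integral_eq_zero (h : IsIndepGaussian N s P) (c : ι →₀ ℝ) :
    ∫ ω, noiseComb N c ω ∂P = 0 := by
  have := h.jointlyGaussian.isProbabilityMeasure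
  induction c using Finsupp.induction_linear with
  | zero => simp
  | add c d hc hd =>
    simp_rw [noiseComb_add]
    rw [integral_add ((h.memLp c).integrable one_le_two) ((h.memLp d).integrable one_le_two),
      hc, hd, add_zero]
  | single i r =>
    have : ∫ ω, N i ω ∂P = 0 := by
      rw [(h.law i).integral_eq, integral_id_gaussianReal]
    simp [noiseComb, integral_const_mul, this]

theorem integral_mul (h : IsIndepGaussian N s P) (c d : ι →₀ ℝ) :
    ∫ ω, noiseComb N c ω * noiseComb N d ω ∂P = covForm s c d := by
  have hi : ∀ c d, Integrable (fun ω => noiseComb N c ω * noiseComb N d ω) P :=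
    fun c d => (h.memLp c).integrable_mul (h.memLp d)
  have hsingle : ∀ i j, ∫ ω, N i ω * N j ω ∂P =
      covForm s (Finsupp.single i 1) (Finsupp.single j 1) := by
    intro i j
    have hz : ∀ i, ∫ ω, N i ω ∂P = 0 := fun i => by
      rw [(h.law i).integral_eq, integral_id_gaussianReal]
    classical
    rw [covForm_single_left, Finsupp.single_apply]
    by_cases hij : i = j
    · subst hij
      have := variance_of_integral_eq_zero (h.law i).aemeasurable (hz i)
      rw [(h.law i).variance_eq, variance_id_gaussianReal] at this
      simp [this, pow_two]
    · have := (h.indep.indepFun hij).integral_fun_mul_eq_mul_integral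
        (h.memLp_noise i).1 (h.memLp_noise j).1
      rw [this, hz, zero_mul, if_neg (Ne.symm hij), mul_zero]
  induction c using Finsupp.induction_linear with
  | zero => simp
  | add c e hc he =>
    simp_rw [noiseComb_add, add_mul]
    rw [integral_add (hi c d) (hi e d), hc, he]; simp
  | single i r =>
    induction d using Finsupp.induction_linear with
    | zero => simp
    | add d e hd he =>
      simp_rw [noiseComb_add, mul_add]
      rw [integral_add (hi _ d) (hi _ e), hd, he]; simp
    | single j t =>
      have e1 : Finsupp.single i r = r • Finsupp.single i (1 : ℝ) := by simp
      have e2 : Finsupp.single j t = t • Finsupp.single j (1 : ℝ) := by simp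
      rw [e1, e2]
      simp_rw [noiseComb_smul, noiseComb_single]
      have : ∀ ω, r * N i ω * (t * N j ω) = (r * t) * (N i ω * N j ω) := fun ω => by ring
      simp_rw [this, integral_const_mul, hsingle]
      simp only [map_smul, LinearMap.smul_apply, smul_eq_mul]
      ring

end IsIndepGaussian

/-- Uncorrelated jointly Gaussian variables are independent, so `noiseComb N z` is orthogonal to
every square-integrable, possibly nonlinear, function of combinations uncorrelated with it. -/
theorem IsIndepGaussian.integral_mul_eq_zero (h : IsIndepGaussian N s P) {z : ι →₀ ℝ}
    {φ : Ω → ℝ} (hφ : Measurable[orthSigma N s z] φ) (hφ2 : MemLp φ 2 P) :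
    ∫ ω, φ ω * noiseComb N z ω ∂P = 0 := by
  have hind : IndepFun
      (fun ω (d : {d : ι →₀ ℝ // covForm s z d = 0}) => noiseComb N d.1 ω)
      (fun ω (_ : Unit) => noiseComb N z ω) P := by
    refine IsGaussianProcess.indepFun_of_covariance_eq_zero
      (X := fun d : {d : ι →₀ ℝ // covForm s z d = 0} => noiseComb N d.1)
      (Y := fun _ : Unit => noiseComb N z) ?_ (fun d => (h.memLp _).1.aemeasurable)
      (fun _ => (h.memLp _).1.aemeasurable) ?_
    · have := h.jointlyGaussian.comp_right
        (Sum.elim (fun d : {d : ι →₀ ℝ // covForm s z d = 0} => d.1) fun _ : Unit => z)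
      have key : (Sum.elim (fun d : {d : ι →₀ ℝ // covForm s z d = 0} => noiseComb N d.1)
          fun _ : Unit => noiseComb N z) = (fun c => noiseComb N c) ∘
            Sum.elim (fun d : {d : ι →₀ ℝ // covForm s z d = 0} => d.1) fun _ : Unit => z := by
        ext i ω
        cases i <;> rfl
      rw [key]
      exact this
    · intro d _
      have := h.jointlyGaussian.isProbabilityMeasure
      rw [covariance_eq_sub (h.memLp _) (h.memLp _), h.integral_eq_zero, zero_mul, sub_zero]
      simp only [Pi.mul_apply]
      rw [h.integral_mul, covForm_comm, d.2]
  have hind2 : IndepFun φ (noiseComb N z) P := by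
    have h2 : IndepFun (fun ω (d : {d : ι →₀ ℝ // covForm s z d = 0}) => noiseComb N d.1 ω)
        (noiseComb N z) P := hind.comp (φ := id) (ψ := fun x : Unit → ℝ => x ())
          measurable_id (measurable_pi_apply _)
    exact indep_of_indep_of_le_left h2 hφ.comap_le
  rw [hind2.integral_fun_mul_eq_mul_integral hφ2.1 (h.memLp z).1, h.integral_eq_zero, mul_zero]

end GaussianSpace

/-! ### The centralized Kalman filter -/

section Filter

/-- The variances of the underlying random variables. -/
def noiseVar (σ₀ σ₁ σ₂ : ℝ≥0) : NoiseIndex → ℝ≥0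
  | .init => σ₀ ^ 2
  | .dist _ => 1
  | .obs₁ _ => σ₁ ^ 2
  | .obs₂ _ => σ₂ ^ 2

theorem IsGaussianNoise.isIndepGaussian {Ω : Type*} [MeasurableSpace Ω] {P : Measure Ω}
    {σ₀ σ₁ σ₂ : ℝ≥0} {x0 : Ω → ℝ} {w v₁ v₂ : ℕ → Ω → ℝ}
    (h : IsGaussianNoise P σ₀ σ₁ σ₂ x0 w v₁ v₂) :
    IsIndepGaussian (noiseFamily x0 w v₁ v₂) (noiseVar σ₀ σ₁ σ₂) P where
  law i := by
    cases i with
    | init => exact h.law_init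
    | dist n => exact h.law_dist n
    | obs₁ n => exact h.law_obs₁ n
    | obs₂ n => exact h.law_obs₂ n
  indep := h.indep

/-- The weights of the two current innovations in the centralized Kalman filter, when the
prediction error has variance `p`. When `σ₁ = 0` the first observation is exact and gets all the
weight. -/
noncomputable def filterGain (σ₁ σ₂ : ℝ≥0) (p : ℝ) : ℝ × ℝ :=
  if σ₁ = 0 then (1, 0) else
    (p * σ₂ ^ 2 / (σ₁ ^ 2 * σ₂ ^ 2 + p * (σ₁ ^ 2 + σ₂ ^ 2)),
      p * σ₁ ^ 2 / (σ₁ ^ 2 * σ₂ ^ 2 + p * (σ₁ ^ 2 + σ₂ ^ 2)))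

/-- The variance of the error after the current observations are used. -/
noncomputable def posteriorVar (σ₁ σ₂ : ℝ≥0) (p : ℝ) : ℝ :=
  (1 - (filterGain σ₁ σ₂ p).1 - (filterGain σ₁ σ₂ p).2) * p

theorem filterGain_fst_mul {σ₁ σ₂ : ℝ≥0} (h : σ₁ ≤ σ₂) {p : ℝ} (hp : 0 ≤ p) :
    (filterGain σ₁ σ₂ p).1 * σ₁ ^ 2 = posteriorVar σ₁ σ₂ p := by
  unfold posteriorVar filterGain
  split_ifs with h0
  · simp [h0]
  · have h1 : (0 : ℝ) < σ₁ := by positivity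
    have h2 : (0 : ℝ) < σ₂ := lt_of_lt_of_le h1 (by exact_mod_cast h)
    have h3 : (0 : ℝ) < σ₁ ^ 2 * σ₂ ^ 2 + p * (σ₁ ^ 2 + σ₂ ^ 2) := by positivity
    field_simp
    ring

theorem filterGain_snd_mul {σ₁ σ₂ : ℝ≥0} (h : σ₁ ≤ σ₂) {p : ℝ} (hp : 0 ≤ p) :
    (filterGain σ₁ σ₂ p).2 * σ₂ ^ 2 = posteriorVar σ₁ σ₂ p := by
  unfold posteriorVar filterGain
  split_ifs with h0
  · simp
  · have h1 : (0 : ℝ) < σ₁ := by positivity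
    have h2 : (0 : ℝ) < σ₂ := lt_of_lt_of_le h1 (by exact_mod_cast h)
    have h3 : (0 : ℝ) < σ₁ ^ 2 * σ₂ ^ 2 + p * (σ₁ ^ 2 + σ₂ ^ 2) := by positivity
    field_simp
    ring

/-- Two observations with noise variances at least `σ₁ ^ 2` are no better than one observation
with noise variance `σ₁ ^ 2 / 2`. -/
theorem le_posteriorVar {σ₁ σ₂ : ℝ≥0} (h : σ₁ ≤ σ₂) {p : ℝ} (hp : 0 ≤ p) :
    p * σ₁ ^ 2 ≤ (σ₁ ^ 2 + 2 * p) * posteriorVar σ₁ σ₂ p := by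
  unfold posteriorVar filterGain
  split_ifs with h0
  · simp [h0]
  · have h1 : (0 : ℝ) < σ₁ := by positivity
    have h12 : (σ₁ : ℝ) ≤ σ₂ := by exact_mod_cast h
    have h2 : (0 : ℝ) < σ₂ := lt_of_lt_of_le h1 h12
    have h3 : (0 : ℝ) < σ₁ ^ 2 * σ₂ ^ 2 + p * (σ₁ ^ 2 + σ₂ ^ 2) := by positivity
    have h4 : (σ₁ : ℝ) ^ 2 ≤ σ₂ ^ 2 := by gcongr
    have e : (1 - p * (σ₂ : ℝ) ^ 2 / (σ₁ ^ 2 * σ₂ ^ 2 + p * (σ₁ ^ 2 + σ₂ ^ 2))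
        - p * (σ₁ : ℝ) ^ 2 / (σ₁ ^ 2 * σ₂ ^ 2 + p * (σ₁ ^ 2 + σ₂ ^ 2))) * p
        = p * σ₁ ^ 2 * σ₂ ^ 2 / (σ₁ ^ 2 * σ₂ ^ 2 + p * (σ₁ ^ 2 + σ₂ ^ 2)) := by
      field_simp
      ring
    simp only [e]
    rw [← mul_div_assoc, le_div_iff₀ h3]
    have : 0 ≤ p * (σ₁ : ℝ) ^ 2 * (p * (σ₂ ^ 2 - σ₁ ^ 2)) := by
      have := sub_nonneg.2 h4
      positivity
    nlinarith

theorem posteriorVar_nonneg {σ₁ σ₂ : ℝ≥0} (h : σ₁ ≤ σ₂) {p : ℝ} (hp : 0 ≤ p) :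
    0 ≤ posteriorVar σ₁ σ₂ p := by
  by_contra hneg
  push Not at hneg
  rcases hp.eq_or_lt with h0 | h0
  · simp [← h0, posteriorVar] at hneg
  · have h1 := le_posteriorVar h hp
    have h2 : 0 < (σ₁ : ℝ) ^ 2 + 2 * p := by positivity
    have h3 : 0 ≤ p * (σ₁ : ℝ) ^ 2 := by positivity
    nlinarith [mul_neg_of_pos_of_neg h2 hneg]

variable (a : ℝ) (σ₀ σ₁ σ₂ : ℝ≥0)

/-- The coefficients of the prediction error of the centralized Kalman filter at time `n`, that
is, of the difference between `x[n]` and its best estimate from all observations `yᵢ[k]`,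
`k < n`. It does not depend on the control laws. -/
noncomputable def filterError : ℕ → NoiseIndex →₀ ℝ
  | 0 => Finsupp.single .init 1
  | n + 1 =>
      a • (filterError n
        - (filterGain σ₁ σ₂ (covForm (noiseVar σ₀ σ₁ σ₂) (filterError n) (filterError n))).1
            • (filterError n + Finsupp.single (.obs₁ n) 1)
        - (filterGain σ₁ σ₂ (covForm (noiseVar σ₀ σ₁ σ₂) (filterError n) (filterError n))).2
            • (filterError n + Finsupp.single (.obs₂ n) 1))
      + Finsupp.single (.dist n) 1

/-- The variance of the prediction error at time `n`. -/
noncomputable def errorVar (n : ℕ) : ℝ :=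
  covForm (noiseVar σ₀ σ₁ σ₂) (filterError a σ₀ σ₁ σ₂ n) (filterError a σ₀ σ₁ σ₂ n)

/-- The innovation in the first controller's observation at time `n`. -/
noncomputable def innovation₁ (n : ℕ) : NoiseIndex →₀ ℝ :=
  filterError a σ₀ σ₁ σ₂ n + Finsupp.single (.obs₁ n) 1

/-- The innovation in the second controller's observation at time `n`. -/
noncomputable def innovation₂ (n : ℕ) : NoiseIndex →₀ ℝ :=
  filterError a σ₀ σ₁ σ₂ n + Finsupp.single (.obs₂ n) 1

theorem filterError_succ (n : ℕ) :
    filterError a σ₀ σ₁ σ₂ (n + 1) =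
      a • (filterError a σ₀ σ₁ σ₂ n
        - (filterGain σ₁ σ₂ (errorVar a σ₀ σ₁ σ₂ n)).1 • innovation₁ a σ₀ σ₁ σ₂ n
        - (filterGain σ₁ σ₂ (errorVar a σ₀ σ₁ σ₂ n)).2 • innovation₂ a σ₀ σ₁ σ₂ n)
      + Finsupp.single (.dist n) 1 := rfl

theorem filterError_apply_of_le (n : ℕ) : ∀ m, n ≤ m →
    filterError a σ₀ σ₁ σ₂ n (.dist m) = 0 ∧ filterError a σ₀ σ₁ σ₂ n (.obs₁ m) = 0 ∧
      filterError a σ₀ σ₁ σ₂ n (.obs₂ m) = 0 := by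
  induction n with
  | zero => intro m _; simp [filterError]
  | succ n ih =>
    intro m hm
    obtain ⟨h1, h2, h3⟩ := ih m (by omega)
    have hne : n ≠ m := by omega
    simp [filterError_succ, innovation₁, innovation₂, h1, h2, h3, hne]

theorem filterError_dist (n : ℕ) : filterError a σ₀ σ₁ σ₂ n (.dist n) = 0 :=
  (filterError_apply_of_le a σ₀ σ₁ σ₂ n n le_rfl).1

theorem filterError_obs₁ (n : ℕ) : filterError a σ₀ σ₁ σ₂ n (.obs₁ n) = 0 :=
  (filterError_apply_of_le a σ₀ σ₁ σ₂ n n le_rfl).2.1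

theorem filterError_obs₂ (n : ℕ) : filterError a σ₀ σ₁ σ₂ n (.obs₂ n) = 0 :=
  (filterError_apply_of_le a σ₀ σ₁ σ₂ n n le_rfl).2.2

theorem covForm_error_innovation₁ (n : ℕ) :
    covForm (noiseVar σ₀ σ₁ σ₂) (filterError a σ₀ σ₁ σ₂ n) (innovation₁ a σ₀ σ₁ σ₂ n)
      = errorVar a σ₀ σ₁ σ₂ n := by
  simp [innovation₁, covForm_single_right, filterError_obs₁, errorVar]

theorem covForm_error_innovation₂ (n : ℕ) :
    covForm (noiseVar σ₀ σ₁ σ₂) (filterError a σ₀ σ₁ σ₂ n) (innovation₂ a σ₀ σ₁ σ₂ n)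
      = errorVar a σ₀ σ₁ σ₂ n := by
  simp [innovation₂, covForm_single_right, filterError_obs₂, errorVar]

theorem covForm_innovation₁_self (n : ℕ) :
    covForm (noiseVar σ₀ σ₁ σ₂) (innovation₁ a σ₀ σ₁ σ₂ n) (innovation₁ a σ₀ σ₁ σ₂ n)
      = errorVar a σ₀ σ₁ σ₂ n + σ₁ ^ 2 := by
  simp [innovation₁, covForm_single_right, covForm_single_left, filterError_obs₁, errorVar,
    noiseVar]

theorem covForm_innovation₂_self (n : ℕ) :
    covForm (noiseVar σ₀ σ₁ σ₂) (innovation₂ a σ₀ σ₁ σ₂ n) (innovation₂ a σ₀ σ₁ σ₂ n)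
      = errorVar a σ₀ σ₁ σ₂ n + σ₂ ^ 2 := by
  simp [innovation₂, covForm_single_right, covForm_single_left, filterError_obs₂, errorVar,
    noiseVar]

theorem covForm_innovation₁_innovation₂ (n : ℕ) :
    covForm (noiseVar σ₀ σ₁ σ₂) (innovation₁ a σ₀ σ₁ σ₂ n) (innovation₂ a σ₀ σ₁ σ₂ n)
      = errorVar a σ₀ σ₁ σ₂ n := by
  simp [innovation₁, innovation₂, covForm_single_right, covForm_single_left, filterError_obs₁,
    filterError_obs₂, errorVar]

theorem errorVar_nonneg (n : ℕ) : 0 ≤ errorVar a σ₀ σ₁ σ₂ n := by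
  have : ∀ c : NoiseIndex →₀ ℝ, 0 ≤ covForm (noiseVar σ₀ σ₁ σ₂) c c := by
    intro c
    simp only [covForm, Finsupp.linearCombination_apply, Finsupp.sum, LinearMap.sum_apply]
    refine Finset.sum_nonneg fun i _ => ?_
    simp only [LinearMap.smul_apply, Finsupp.lapply_apply, smul_eq_mul]
    have := (noiseVar σ₀ σ₁ σ₂ i).2
    nlinarith [mul_nonneg this (mul_self_nonneg (c i))]
  exact this _

variable {σ₁ σ₂}

/-- The prediction error is uncorrelated with all earlier innovations. -/
theorem covForm_error_innovation_eq_zero (h : σ₁ ≤ σ₂) (n : ℕ) : ∀ k < n,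
    covForm (noiseVar σ₀ σ₁ σ₂) (filterError a σ₀ σ₁ σ₂ n) (innovation₁ a σ₀ σ₁ σ₂ k) = 0 ∧
    covForm (noiseVar σ₀ σ₁ σ₂) (filterError a σ₀ σ₁ σ₂ n) (innovation₂ a σ₀ σ₁ σ₂ k) = 0 := by
  induction n with
  | zero => intro k hk; omega
  | succ n ih =>
    intro k hk
    rcases Nat.lt_succ_iff_lt_or_eq.1 hk with hk | rfl
    · obtain ⟨i1, i2⟩ := ih k hk
      obtain ⟨e1, e2, e3⟩ := filterError_apply_of_le a σ₀ σ₁ σ₂ k n hk.le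
      have hne : k ≠ n := hk.ne
      rw [filterError_succ]
      have hj : ∀ d : NoiseIndex →₀ ℝ,
          covForm (noiseVar σ₀ σ₁ σ₂) (filterError a σ₀ σ₁ σ₂ n) d = 0 →
          d (.obs₁ n) = 0 → d (.obs₂ n) = 0 → d (.dist n) = 0 →
          covForm (noiseVar σ₀ σ₁ σ₂) (a • (filterError a σ₀ σ₁ σ₂ n
            - (filterGain σ₁ σ₂ (errorVar a σ₀ σ₁ σ₂ n)).1 • innovation₁ a σ₀ σ₁ σ₂ n
            - (filterGain σ₁ σ₂ (errorVar a σ₀ σ₁ σ₂ n)).2 • innovation₂ a σ₀ σ₁ σ₂ n)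
            + Finsupp.single (.dist n) 1) d = 0 := by
        intro d h0 h1 h2 h3
        simp only [innovation₁, innovation₂, map_add, map_sub, map_smul, LinearMap.add_apply,
          LinearMap.sub_apply, LinearMap.smul_apply, smul_eq_mul, covForm_single_left,
          h0, h1, h2, h3, mul_zero, add_zero, sub_zero]
      refine ⟨hj _ i1 ?_ ?_ ?_, hj _ i2 ?_ ?_ ?_⟩ <;>
        simp [innovation₁, innovation₂, e1, e2, e3, hne]
    · have hp := errorVar_nonneg a σ₀ σ₁ σ₂ k
      have g1 := filterGain_fst_mul h hp
      have g2 := filterGain_snd_mul h hp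
      have d1 : innovation₁ a σ₀ σ₁ σ₂ k (.dist k) = 0 := by
        simp [innovation₁, filterError_dist]
      have d2 : innovation₂ a σ₀ σ₁ σ₂ k (.dist k) = 0 := by
        simp [innovation₂, filterError_dist]
      rw [filterError_succ]
      simp only [map_add, map_sub, map_smul, LinearMap.add_apply, LinearMap.sub_apply,
        LinearMap.smul_apply, smul_eq_mul, covForm_single_left, d1, d2,
        covForm_error_innovation₁, covForm_error_innovation₂, covForm_innovation₁_self,
        covForm_innovation₂_self, covForm_innovation₁_innovation₂,
        covForm_comm (innovation₂ a σ₀ σ₁ σ₂ k) (innovation₁ a σ₀ σ₁ σ₂ k)]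
      unfold posteriorVar at g1 g2
      constructor
      · linear_combination (-a) * g1
      · linear_combination (-a) * g2

theorem errorVar_succ (h : σ₁ ≤ σ₂) (n : ℕ) :
    errorVar a σ₀ σ₁ σ₂ (n + 1) = a ^ 2 * posteriorVar σ₁ σ₂ (errorVar a σ₀ σ₁ σ₂ n) + 1 := by
  have hp := errorVar_nonneg a σ₀ σ₁ σ₂ n
  have g1 := filterGain_fst_mul h hp
  have g2 := filterGain_snd_mul h hp
  obtain ⟨h1, h2⟩ := covForm_error_innovation_eq_zero a σ₀ h (n + 1) n (Nat.lt_succ_self n)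
  rw [errorVar]
  nth_rewrite 2 [filterError_succ]
  simp only [map_add, map_sub, map_smul, smul_eq_mul, h1, h2]
  rw [filterError_succ]
  have d1 : innovation₁ a σ₀ σ₁ σ₂ n (.dist n) = 0 := by
    simp [innovation₁, filterError_dist]
  have d2 : innovation₂ a σ₀ σ₁ σ₂ n (.dist n) = 0 := by
    simp [innovation₂, filterError_dist]
  have d3 := filterError_dist a σ₀ σ₁ σ₂ n
  simp only [map_add, map_sub, map_smul, LinearMap.add_apply, LinearMap.sub_apply,
    LinearMap.smul_apply, smul_eq_mul, covForm_single_left, covForm_single_right, d1, d2, d3,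
    Finsupp.single_eq_same,
    covForm_comm (innovation₁ a σ₀ σ₁ σ₂ n) (filterError a σ₀ σ₁ σ₂ n),
    covForm_comm (innovation₂ a σ₀ σ₁ σ₂ n) (filterError a σ₀ σ₁ σ₂ n),
    covForm_error_innovation₁, covForm_error_innovation₂]
  rw [← errorVar]
  simp only [noiseVar, posteriorVar, NNReal.coe_one]
  ring

theorem one_le_errorVar_succ (h : σ₁ ≤ σ₂) (n : ℕ) : 1 ≤ errorVar a σ₀ σ₁ σ₂ (n + 1) := by
  rw [errorVar_succ a σ₀ h]
  have := posteriorVar_nonneg h (errorVar_nonneg a σ₀ σ₁ σ₂ n)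
  nlinarith [mul_nonneg (sq_nonneg a) this]

variable {a}

/-- The prediction error stays large: averaging the two observations at best halves the noise
variance `σ₁ ^ 2`, and one step multiplies the remaining variance by `a ^ 2`. The constant
`2 / 5 < 1 / 2` leaves room for the transient and for finite `a`. -/
theorem eventually_le_errorVar (h : σ₁ ≤ σ₂) (ha : 2.5 ≤ |a|) :
    ∃ n₀, ∀ n ≥ n₀, 1 ≤ errorVar a σ₀ σ₁ σ₂ n ∧
      2 / 5 * max 1 (a ^ 2 * (σ₁ : ℝ) ^ 2) ≤ errorVar a σ₀ σ₁ σ₂ n := by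
  have ha2 : 6.25 ≤ a ^ 2 := by
    rw [← sq_abs]; nlinarith
  set t := a ^ 2 * (σ₁ : ℝ) ^ 2 with ht
  have ht0 : 0 ≤ t := by positivity
  -- along the Riccati recursion for `p`, the ratio `t / p` is dominated by `z ↦ z / a ^ 2 + 2`
  have key : ∀ n, t ≤ (2.4 + 0.16 ^ n * t) * errorVar a σ₀ σ₁ σ₂ (n + 1) := by
    intro n
    induction n with
    | zero =>
      have := one_le_errorVar_succ a σ₀ h 0
      nlinarith
    | succ n ih =>
      set p := errorVar a σ₀ σ₁ σ₂ (n + 1) with hp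
      have hp1 : 1 ≤ p := one_le_errorVar_succ a σ₀ h n
      have h1 := le_posteriorVar h (zero_le_one.trans hp1)
      rw [errorVar_succ a σ₀ h, ← hp]
      set c := posteriorVar σ₁ σ₂ p
      set z := (0.16 : ℝ) ^ n * t with hz
      have hz0 : 0 ≤ z := by positivity
      have hz' : (0.16 : ℝ) ^ (n + 1) * t = 0.16 * z := by rw [hz]; ring
      rw [hz']
      have hs : (0 : ℝ) ≤ (σ₁ : ℝ) ^ 2 := by positivity
      have hst : (σ₁ : ℝ) ^ 2 ≤ 0.16 * t := by nlinarith
      have hc0 : 0 ≤ c := posteriorVar_nonneg h (zero_le_one.trans hp1)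
      -- `p t ≤ (σ₁² + 2 p) a² c` and `σ₁² ≤ 0.16 t ≤ 0.16 (2.4 + z) p`
      have h4 : p * t ≤ ((σ₁ : ℝ) ^ 2 + 2 * p) * (a ^ 2 * c) := by
        calc p * t = a ^ 2 * (p * (σ₁ : ℝ) ^ 2) := by rw [ht]; ring
          _ ≤ a ^ 2 * (((σ₁ : ℝ) ^ 2 + 2 * p) * c) := by gcongr
          _ = _ := by ring
      have h5 : (σ₁ : ℝ) ^ 2 + 2 * p ≤ (2.4 + 0.16 * z) * p := by nlinarith
      have h6 : p * t ≤ p * ((2.4 + 0.16 * z) * (a ^ 2 * c)) := by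
        calc p * t ≤ ((σ₁ : ℝ) ^ 2 + 2 * p) * (a ^ 2 * c) := h4
          _ ≤ ((2.4 + 0.16 * z) * p) * (a ^ 2 * c) := by gcongr
          _ = _ := by ring
      have h7 := le_of_mul_le_mul_left h6 (by linarith)
      nlinarith
  have hlim : Tendsto (fun n : ℕ => (0.16 : ℝ) ^ n * t) atTop (nhds (0 * t)) :=
    (tendsto_pow_atTop_nhds_zero_of_lt_one (by norm_num) (by norm_num)).mul_const t
  rw [zero_mul] at hlim
  obtain ⟨n₁, hn₁⟩ := eventually_atTop.1
    (hlim.eventually (gt_mem_nhds (show (0 : ℝ) < 0.1 by norm_num)))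
  refine ⟨n₁ + 1, fun n hn => ?_⟩
  obtain ⟨m, rfl⟩ : ∃ m, n = m + 1 := ⟨n - 1, by omega⟩
  have h1 := one_le_errorVar_succ a σ₀ h m
  refine ⟨h1, ?_⟩
  have h2 := hn₁ m (by omega)
  have h3 := key m
  rcases max_cases 1 t with ⟨h4, _⟩ | ⟨h4, _⟩ <;> rw [h4]
  · linarith
  · nlinarith

end Filter

/-! ### The closed loop and its prediction -/

section ClosedLoop

variable {Ω : Type*} (a : ℝ) (f₁ f₂ : Controller) (N : NoiseIndex → Ω → ℝ)

/-- The closed-loop state as a function of time and of the sample point. -/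
noncomputable def stateVar (n : ℕ) (ω : Ω) : ℝ :=
  state a f₁ f₂ (N .init ω) (fun k => N (.dist k) ω) (fun k => N (.obs₁ k) ω)
    (fun k => N (.obs₂ k) ω) n

/-- The input of the first controller in closed loop. -/
noncomputable def inputVar₁ (n : ℕ) (ω : Ω) : ℝ :=
  controlInput f₁ (fun k => stateVar a f₁ f₂ N k ω) (fun k => N (.obs₁ k) ω) n

/-- The input of the second controller in closed loop. -/
noncomputable def inputVar₂ (n : ℕ) (ω : Ω) : ℝ :=
  controlInput f₂ (fun k => stateVar a f₁ f₂ N k ω) (fun k => N (.obs₂ k) ω) n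

theorem stateVar_succ (n : ℕ) (ω : Ω) :
    stateVar a f₁ f₂ N (n + 1) ω = a * stateVar a f₁ f₂ N n ω + inputVar₁ a f₁ f₂ N n ω
      + inputVar₂ a f₁ f₂ N n ω + N (.dist n) ω :=
  state_succ ..

variable {a f₁ f₂ N}

theorem aemeasurable_inputVar [MeasurableSpace Ω] {P : Measure Ω}
    (hN : ∀ i, AEMeasurable (N i) P) {n : ℕ}
    (h : ∀ k ≤ n, AEMeasurable (stateVar a f₁ f₂ N k) P) :
    AEMeasurable (inputVar₁ a f₁ f₂ N n) P ∧ AEMeasurable (inputVar₂ a f₁ f₂ N n) P := by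
  constructor
  · exact (f₁.measurable_law n).comp_aemeasurable (aemeasurable_pi_lambda _ fun i =>
      (h i.1 (Nat.lt_succ_iff.1 i.2)).add (hN _))
  · exact (f₂.measurable_law n).comp_aemeasurable (aemeasurable_pi_lambda _ fun i =>
      (h i.1 (Nat.lt_succ_iff.1 i.2)).add (hN _))

theorem aemeasurable_stateVar [MeasurableSpace Ω] {P : Measure Ω}
    (hN : ∀ i, AEMeasurable (N i) P) (n : ℕ) : AEMeasurable (stateVar a f₁ f₂ N n) P := by
  induction n using Nat.strong_induction_on with
  | _ n ih =>
    cases n with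
    | zero =>
      have : stateVar a f₁ f₂ N 0 = N .init := by
        ext ω; exact state_zero ..
      rw [this]; exact hN _
    | succ n =>
      have : stateVar a f₁ f₂ N (n + 1) = fun ω => a * stateVar a f₁ f₂ N n ω
          + inputVar₁ a f₁ f₂ N n ω + inputVar₂ a f₁ f₂ N n ω + N (.dist n) ω := by
        ext ω; exact stateVar_succ ..
      rw [this]
      obtain ⟨h1, h2⟩ := aemeasurable_inputVar (a := a) (f₁ := f₁) (f₂ := f₂) hN
        (n := n) fun k hk => ih k (by omega)
      exact ((((ih n (by omega)).const_mul a).add h1).add h2).add (hN _)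

theorem aemeasurable_inputVar₁ [MeasurableSpace Ω] {P : Measure Ω}
    (hN : ∀ i, AEMeasurable (N i) P) (n : ℕ) : AEMeasurable (inputVar₁ a f₁ f₂ N n) P :=
  (aemeasurable_inputVar hN fun k _ => aemeasurable_stateVar hN k).1

theorem aemeasurable_inputVar₂ [MeasurableSpace Ω] {P : Measure Ω}
    (hN : ∀ i, AEMeasurable (N i) P) (n : ℕ) : AEMeasurable (inputVar₂ a f₁ f₂ N n) P :=
  (aemeasurable_inputVar hN fun k _ => aemeasurable_stateVar hN k).2

variable (a f₁ f₂ N) (σ₀ σ₁ σ₂ : ℝ≥0)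

/-- The centralized Kalman prediction of the state. -/
noncomputable def prediction (n : ℕ) (ω : Ω) : ℝ :=
  stateVar a f₁ f₂ N n ω - noiseComb N (filterError a σ₀ σ₁ σ₂ n) ω

theorem prediction_succ (n : ℕ) (ω : Ω) :
    prediction a f₁ f₂ N σ₀ σ₁ σ₂ (n + 1) ω =
      a * (prediction a f₁ f₂ N σ₀ σ₁ σ₂ n ω
        + (filterGain σ₁ σ₂ (errorVar a σ₀ σ₁ σ₂ n)).1
          * noiseComb N (innovation₁ a σ₀ σ₁ σ₂ n) ω
        + (filterGain σ₁ σ₂ (errorVar a σ₀ σ₁ σ₂ n)).2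
          * noiseComb N (innovation₂ a σ₀ σ₁ σ₂ n) ω)
      + inputVar₁ a f₁ f₂ N n ω + inputVar₂ a f₁ f₂ N n ω := by
  simp only [prediction, stateVar_succ, filterError_succ, noiseComb_add, noiseComb_sub,
    noiseComb_smul, noiseComb_single]
  ring

theorem observation₁_eq (n : ℕ) (ω : Ω) :
    stateVar a f₁ f₂ N n ω + N (.obs₁ n) ω =
      prediction a f₁ f₂ N σ₀ σ₁ σ₂ n ω + noiseComb N (innovation₁ a σ₀ σ₁ σ₂ n) ω := by
  simp only [prediction, innovation₁, noiseComb_add, noiseComb_single]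
  ring

theorem observation₂_eq (n : ℕ) (ω : Ω) :
    stateVar a f₁ f₂ N n ω + N (.obs₂ n) ω =
      prediction a f₁ f₂ N σ₀ σ₁ σ₂ n ω + noiseComb N (innovation₂ a σ₀ σ₁ σ₂ n) ω := by
  simp only [prediction, innovation₂, noiseComb_add, noiseComb_single]
  ring

variable {σ₀ σ₁ σ₂} {z : NoiseIndex →₀ ℝ} {n : ℕ}

theorem measurable_inputVar₁_of_prediction
    (hz : ∀ k ≤ n, covForm (noiseVar σ₀ σ₁ σ₂) z (innovation₁ a σ₀ σ₁ σ₂ k) = 0)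
    (hm : ∀ k ≤ n, Measurable[orthSigma N (noiseVar σ₀ σ₁ σ₂) z]
      (prediction a f₁ f₂ N σ₀ σ₁ σ₂ k)) :
    Measurable[orthSigma N (noiseVar σ₀ σ₁ σ₂) z] (inputVar₁ a f₁ f₂ N n) := by
  refine (f₁.measurable_law n).comp (@measurable_pi_lambda _ _ _ (_) _ _ fun i => ?_)
  have hi := Nat.lt_succ_iff.1 i.2
  have : (fun ω => stateVar a f₁ f₂ N i.1 ω + N (.obs₁ i.1) ω) = fun ω =>
      prediction a f₁ f₂ N σ₀ σ₁ σ₂ i.1 ω + noiseComb N (innovation₁ a σ₀ σ₁ σ₂ i.1) ω := by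
    ext ω; exact observation₁_eq ..
  rw [this]
  exact (hm _ hi).add (measurable_orthSigma (hz _ hi))

theorem measurable_inputVar₂_of_prediction
    (hz : ∀ k ≤ n, covForm (noiseVar σ₀ σ₁ σ₂) z (innovation₂ a σ₀ σ₁ σ₂ k) = 0)
    (hm : ∀ k ≤ n, Measurable[orthSigma N (noiseVar σ₀ σ₁ σ₂) z]
      (prediction a f₁ f₂ N σ₀ σ₁ σ₂ k)) :
    Measurable[orthSigma N (noiseVar σ₀ σ₁ σ₂) z] (inputVar₂ a f₁ f₂ N n) := by
  refine (f₂.measurable_law n).comp (@measurable_pi_lambda _ _ _ (_) _ _ fun i => ?_)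
  have hi := Nat.lt_succ_iff.1 i.2
  have : (fun ω => stateVar a f₁ f₂ N i.1 ω + N (.obs₂ i.1) ω) = fun ω =>
      prediction a f₁ f₂ N σ₀ σ₁ σ₂ i.1 ω + noiseComb N (innovation₂ a σ₀ σ₁ σ₂ i.1) ω := by
    ext ω; exact observation₂_eq ..
  rw [this]
  exact (hm _ hi).add (measurable_orthSigma (hz _ hi))

/-- The prediction at time `n` is a function of the innovations before time `n`, for arbitrary
control laws. -/
theorem measurable_prediction
    (hz : ∀ k < n, covForm (noiseVar σ₀ σ₁ σ₂) z (innovation₁ a σ₀ σ₁ σ₂ k) = 0 ∧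
      covForm (noiseVar σ₀ σ₁ σ₂) z (innovation₂ a σ₀ σ₁ σ₂ k) = 0) :
    Measurable[orthSigma N (noiseVar σ₀ σ₁ σ₂) z] (prediction a f₁ f₂ N σ₀ σ₁ σ₂ n) := by
  induction n using Nat.strong_induction_on with
  | _ n ih =>
    cases n with
    | zero =>
      have : prediction a f₁ f₂ N σ₀ σ₁ σ₂ 0 = fun _ => 0 := by
        ext ω
        simp only [prediction, stateVar, state_zero, filterError, noiseComb_single, sub_self]
      rw [this]
      exact measurable_const
    | succ n =>
      have : prediction a f₁ f₂ N σ₀ σ₁ σ₂ (n + 1) = _ :=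
        funext fun ω => prediction_succ a f₁ f₂ N σ₀ σ₁ σ₂ n ω
      rw [this]
      have hm : ∀ k ≤ n, Measurable[orthSigma N (noiseVar σ₀ σ₁ σ₂) z]
          (prediction a f₁ f₂ N σ₀ σ₁ σ₂ k) :=
        fun k hk => ih k (by omega) fun j hj => hz j (by omega)
      have h1 := measurable_inputVar₁_of_prediction a f₁ f₂ N
        (fun k (hk : k ≤ n) => (hz k (by omega)).1) hm
      have h2 := measurable_inputVar₂_of_prediction a f₁ f₂ N
        (fun k (hk : k ≤ n) => (hz k (by omega)).2) hm
      have i1 := measurable_orthSigma (N := N) (hz n (by omega)).1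
      have i2 := measurable_orthSigma (N := N) (hz n (by omega)).2
      exact ((((hm n le_rfl).add (i1.const_mul _)).add (i2.const_mul _)).const_mul _
        |>.add h1).add h2

theorem measurable_inputVar₁
    (hz : ∀ k < n, covForm (noiseVar σ₀ σ₁ σ₂) z (innovation₁ a σ₀ σ₁ σ₂ k) = 0 ∧
      covForm (noiseVar σ₀ σ₁ σ₂) z (innovation₂ a σ₀ σ₁ σ₂ k) = 0)
    (hn : covForm (noiseVar σ₀ σ₁ σ₂) z (innovation₁ a σ₀ σ₁ σ₂ n) = 0) :
    Measurable[orthSigma N (noiseVar σ₀ σ₁ σ₂) z] (inputVar₁ a f₁ f₂ N n) :=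
  measurable_inputVar₁_of_prediction a f₁ f₂ N
    (fun k hk => hk.lt_or_eq.elim (fun h => (hz k h).1) fun h => h ▸ hn)
    fun _ hk => measurable_prediction a f₁ f₂ N fun j hj => hz j (hj.trans_le hk)

theorem measurable_inputVar₂
    (hz : ∀ k < n, covForm (noiseVar σ₀ σ₁ σ₂) z (innovation₁ a σ₀ σ₁ σ₂ k) = 0 ∧
      covForm (noiseVar σ₀ σ₁ σ₂) z (innovation₂ a σ₀ σ₁ σ₂ k) = 0)
    (hn : covForm (noiseVar σ₀ σ₁ σ₂) z (innovation₂ a σ₀ σ₁ σ₂ n) = 0) :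
    Measurable[orthSigma N (noiseVar σ₀ σ₁ σ₂) z] (inputVar₂ a f₁ f₂ N n) :=
  measurable_inputVar₂_of_prediction a f₁ f₂ N
    (fun k hk => hk.lt_or_eq.elim (fun h => (hz k h).2) fun h => h ▸ hn)
    fun _ hk => measurable_prediction a f₁ f₂ N fun j hj => hz j (hj.trans_le hk)

end ClosedLoop

/-! ### Second-moment inequalities for arbitrary control laws -/

section SecondMoments

variable {Ω : Type*} [MeasurableSpace Ω] {P : Measure Ω} {a : ℝ} {f₁ f₂ : Controller}
  {N : NoiseIndex → Ω → ℝ} {σ₀ σ₁ σ₂ : ℝ≥0}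

theorem errorVar_le_integral_sq (hN : IsIndepGaussian N (noiseVar σ₀ σ₁ σ₂) P) (h : σ₁ ≤ σ₂)
    {n : ℕ} (hx : MemLp (stateVar a f₁ f₂ N n) 2 P) :
    errorVar a σ₀ σ₁ σ₂ n ≤ ∫ ω, stateVar a f₁ f₂ N n ω ^ 2 ∂P := by
  have hξ := hN.memLp (filterError a σ₀ σ₁ σ₂ n)
  have hm2 : MemLp (prediction a f₁ f₂ N σ₀ σ₁ σ₂ n) 2 P := hx.sub hξ
  have hm := measurable_prediction a f₁ f₂ N (covForm_error_innovation_eq_zero a σ₀ h n)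
  have e1 := hN.integral_mul_eq_zero hm hm2
  have e2 := hN.integral_mul (filterError a σ₀ σ₁ σ₂ n) (filterError a σ₀ σ₁ σ₂ n)
  have i1 := hm2.integrable_mul hξ
  have i2 := hξ.integrable_mul hξ
  calc errorVar a σ₀ σ₁ σ₂ n
      = ∫ ω, 2 * (prediction a f₁ f₂ N σ₀ σ₁ σ₂ n ω * noiseComb N (filterError a σ₀ σ₁ σ₂ n) ω)
          + noiseComb N (filterError a σ₀ σ₁ σ₂ n) ω * noiseComb N (filterError a σ₀ σ₁ σ₂ n) ω
          ∂P := by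
        rw [integral_add, integral_const_mul, e1, e2, errorVar]
        · ring
        · exact i1.const_mul 2
        · exact i2
    _ ≤ _ := by
        refine integral_mono ((i1.const_mul 2).add i2) hx.integrable_sq fun ω => ?_
        have : stateVar a f₁ f₂ N n ω = prediction a f₁ f₂ N σ₀ σ₁ σ₂ n ω
          + noiseComb N (filterError a σ₀ σ₁ σ₂ n) ω := by simp only [prediction]; ring
        simp only [this]
        nlinarith [sq_nonneg (prediction a f₁ f₂ N σ₀ σ₁ σ₂ n ω)]

theorem memLp_inputVar₂ (hN : IsIndepGaussian N (noiseVar σ₀ σ₁ σ₂) P) {n : ℕ}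
    (hx : MemLp (stateVar a f₁ f₂ N n) 2 P) (hx' : MemLp (stateVar a f₁ f₂ N (n + 1)) 2 P)
    (hu : MemLp (inputVar₁ a f₁ f₂ N n) 2 P) : MemLp (inputVar₂ a f₁ f₂ N n) 2 P := by
  have : inputVar₂ a f₁ f₂ N n = stateVar a f₁ f₂ N (n + 1) - a • stateVar a f₁ f₂ N n
      - inputVar₁ a f₁ f₂ N n - N (.dist n) := by
    ext ω
    simp only [Pi.sub_apply, Pi.smul_apply, smul_eq_mul, stateVar_succ]
    ring
  rw [this]
  exact ((hx'.sub (hx.const_smul a)).sub hu).sub (hN.memLp_noise _)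

/-- The linear combination of the prediction error and the second innovation that is
uncorrelated with the second innovation. -/
noncomputable def residual₂ (a : ℝ) (σ₀ σ₁ σ₂ : ℝ≥0) (n : ℕ) : NoiseIndex →₀ ℝ :=
  filterError a σ₀ σ₁ σ₂ n
    - (errorVar a σ₀ σ₁ σ₂ n / (errorVar a σ₀ σ₁ σ₂ n + σ₂ ^ 2)) • innovation₂ a σ₀ σ₁ σ₂ n

/-- The variance of `residual₂`: the mean-square error of the second controller in estimating the
prediction error from its current innovation. -/
noncomputable def residualVar₂ (a : ℝ) (σ₀ σ₁ σ₂ : ℝ≥0) (n : ℕ) : ℝ :=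
  errorVar a σ₀ σ₁ σ₂ n * σ₂ ^ 2 / (errorVar a σ₀ σ₁ σ₂ n + σ₂ ^ 2)

variable (a σ₀) in
theorem covForm_innovation₁_innovation_eq_zero (h : σ₁ ≤ σ₂) {n k : ℕ} (hk : k < n) :
    covForm (noiseVar σ₀ σ₁ σ₂) (innovation₁ a σ₀ σ₁ σ₂ n) (innovation₁ a σ₀ σ₁ σ₂ k) = 0 ∧
    covForm (noiseVar σ₀ σ₁ σ₂) (innovation₁ a σ₀ σ₁ σ₂ n) (innovation₂ a σ₀ σ₁ σ₂ k) = 0 := by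
  obtain ⟨h1, h2⟩ := covForm_error_innovation_eq_zero a σ₀ h n k hk
  obtain ⟨e1, e2, e3⟩ := filterError_apply_of_le a σ₀ σ₁ σ₂ k n hk.le
  have hne : k ≠ n := hk.ne
  constructor
  · rw [innovation₁, map_add, LinearMap.add_apply, h1, covForm_single_left]
    simp [innovation₁, e2, hne]
  · rw [innovation₁, map_add, LinearMap.add_apply, h2, covForm_single_left]
    simp [innovation₂, e2]

variable (a σ₀) in
theorem covForm_innovation₂_innovation_eq_zero (h : σ₁ ≤ σ₂) {n k : ℕ} (hk : k < n) :
    covForm (noiseVar σ₀ σ₁ σ₂) (innovation₂ a σ₀ σ₁ σ₂ n) (innovation₁ a σ₀ σ₁ σ₂ k) = 0 ∧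
    covForm (noiseVar σ₀ σ₁ σ₂) (innovation₂ a σ₀ σ₁ σ₂ n) (innovation₂ a σ₀ σ₁ σ₂ k) = 0 := by
  obtain ⟨h1, h2⟩ := covForm_error_innovation_eq_zero a σ₀ h n k hk
  obtain ⟨e1, e2, e3⟩ := filterError_apply_of_le a σ₀ σ₁ σ₂ k n hk.le
  have hne : k ≠ n := hk.ne
  constructor
  · rw [innovation₂, map_add, LinearMap.add_apply, h1, covForm_single_left]
    simp [innovation₁, e3]
  · rw [innovation₂, map_add, LinearMap.add_apply, h2, covForm_single_left]
    simp [innovation₂, e3, hne]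

/-- A controller that only sees `y₂` cannot cancel `residual₂`, and the first controller, which
does not see it exactly either, needs a large input to do so. The parameters `r` and `t` are the
multipliers of the two applications of Young's inequality. -/
theorem young_residualVar₂_le (hN : IsIndepGaussian N (noiseVar σ₀ σ₁ σ₂) P) (h : σ₁ ≤ σ₂)
    {n : ℕ} (hp : 0 < errorVar a σ₀ σ₁ σ₂ n)
    (hx : MemLp (stateVar a f₁ f₂ N n) 2 P) (hx' : MemLp (stateVar a f₁ f₂ N (n + 1)) 2 P)
    (hu : MemLp (inputVar₁ a f₁ f₂ N n) 2 P) (r : ℝ) {t : ℝ} (ht : 0 < t) :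
    2 * r * a * residualVar₂ a σ₀ σ₁ σ₂ n ≤
      ∫ ω, stateVar a f₁ f₂ N (n + 1) ω ^ 2 ∂P + r ^ 2 * residualVar₂ a σ₀ σ₁ σ₂ n
        + t * ∫ ω, inputVar₁ a f₁ f₂ N n ω ^ 2 ∂P
        + r ^ 2 * residualVar₂ a σ₀ σ₁ σ₂ n ^ 2 / (t * (errorVar a σ₀ σ₁ σ₂ n + σ₁ ^ 2)) := by
  have hu2 := memLp_inputVar₂ hN hx hx' hu
  set p := errorVar a σ₀ σ₁ σ₂ n with hpdef
  set e := residualVar₂ a σ₀ σ₁ σ₂ n with he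
  set ξ := filterError a σ₀ σ₁ σ₂ n with hξ
  set i₁ := innovation₁ a σ₀ σ₁ σ₂ n with hi₁
  set i₂ := innovation₂ a σ₀ σ₁ σ₂ n with hi₂
  set z := residual₂ a σ₀ σ₁ σ₂ n with hz
  have hzdef : z = ξ - (p / (p + σ₂ ^ 2)) • i₂ := rfl
  have hp1 : 0 < p + (σ₁ : ℝ) ^ 2 := by positivity
  have hp2 : 0 < p + (σ₂ : ℝ) ^ 2 := by positivity
  have heq : e = p - p / (p + σ₂ ^ 2) * p := by
    simp only [he, residualVar₂, ← hpdef]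
    field_simp
    ring
  set κ := e / (p + (σ₁ : ℝ) ^ 2) with hκ
  set z' := z - κ • i₁ with hz'
  have cξξ : covForm (noiseVar σ₀ σ₁ σ₂) ξ ξ = p := rfl
  have cξ1 : covForm (noiseVar σ₀ σ₁ σ₂) ξ i₁ = p := covForm_error_innovation₁ ..
  have cξ2 : covForm (noiseVar σ₀ σ₁ σ₂) ξ i₂ = p := covForm_error_innovation₂ ..
  have c11 : covForm (noiseVar σ₀ σ₁ σ₂) i₁ i₁ = p + σ₁ ^ 2 := covForm_innovation₁_self ..
  have c22 : covForm (noiseVar σ₀ σ₁ σ₂) i₂ i₂ = p + σ₂ ^ 2 := covForm_innovation₂_self ..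
  have c12 : covForm (noiseVar σ₀ σ₁ σ₂) i₁ i₂ = p := covForm_innovation₁_innovation₂ ..
  have cz2 : covForm (noiseVar σ₀ σ₁ σ₂) z i₂ = 0 := by
    simp only [hzdef, map_sub, map_smul, LinearMap.sub_apply, LinearMap.smul_apply, smul_eq_mul,
      cξ2, c22]
    field_simp
    ring
  have czξ : covForm (noiseVar σ₀ σ₁ σ₂) z ξ = e := by
    simp only [hzdef, map_sub, map_smul, LinearMap.sub_apply, LinearMap.smul_apply, smul_eq_mul,
      cξξ, covForm_comm i₂ ξ, cξ2, heq]
  have cz1 : covForm (noiseVar σ₀ σ₁ σ₂) z i₁ = e := by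
    simp only [hzdef, map_sub, map_smul, LinearMap.sub_apply, LinearMap.smul_apply, smul_eq_mul,
      cξ1, covForm_comm i₂ i₁, c12, heq]
  have czz : covForm (noiseVar σ₀ σ₁ σ₂) z z = e := by
    nth_rewrite 2 [hzdef]
    rw [map_sub, map_smul, cz2, smul_zero, sub_zero, czξ]
  have czw : covForm (noiseVar σ₀ σ₁ σ₂) z (Finsupp.single (.dist n) 1) = 0 := by
    rw [covForm_single_right]
    simp [hzdef, hξ, hi₂, innovation₂, filterError_dist]
  have cz'1 : covForm (noiseVar σ₀ σ₁ σ₂) z' i₁ = 0 := by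
    simp only [hz', map_sub, map_smul, LinearMap.sub_apply, LinearMap.smul_apply, smul_eq_mul,
      cz1, c11, hκ]
    field_simp
    ring
  have hzpast : ∀ k < n, covForm (noiseVar σ₀ σ₁ σ₂) z (innovation₁ a σ₀ σ₁ σ₂ k) = 0 ∧
      covForm (noiseVar σ₀ σ₁ σ₂) z (innovation₂ a σ₀ σ₁ σ₂ k) = 0 := by
    intro k hk
    obtain ⟨h1, h2⟩ := covForm_error_innovation_eq_zero a σ₀ h n k hk
    obtain ⟨h3, h4⟩ := covForm_innovation₂_innovation_eq_zero a σ₀ h hk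
    simp [hzdef, hξ, hi₂, h1, h2, h3, h4]
  have hz'past : ∀ k < n, covForm (noiseVar σ₀ σ₁ σ₂) z' (innovation₁ a σ₀ σ₁ σ₂ k) = 0 ∧
      covForm (noiseVar σ₀ σ₁ σ₂) z' (innovation₂ a σ₀ σ₁ σ₂ k) = 0 := by
    intro k hk
    obtain ⟨h1, h2⟩ := hzpast k hk
    obtain ⟨h3, h4⟩ := covForm_innovation₁_innovation_eq_zero a σ₀ h hk
    simp [hz', hi₁, h1, h2, h3, h4]
  have hm2 : MemLp (prediction a f₁ f₂ N σ₀ σ₁ σ₂ n) 2 P := hx.sub (hN.memLp _)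
  -- the part of the state known in advance and the second input do not see `z`
  have o1 := hN.integral_mul_eq_zero (measurable_prediction a f₁ f₂ N hzpast) hm2
  have o2 := hN.integral_mul_eq_zero (measurable_inputVar₂ a f₁ f₂ N hzpast cz2) hu2
  -- the first input sees `z` only through the first innovation
  have o3 := hN.integral_mul_eq_zero (measurable_inputVar₁ a f₁ f₂ N hz'past cz'1) hu
  have o4 := hN.integral_mul ξ z
  have o5 := hN.integral_mul (Finsupp.single (.dist n) 1) z
  have o6 := hN.integral_mul z z
  have o7 := hN.integral_mul i₁ i₁
  rw [covForm_comm, czξ] at o4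
  rw [covForm_comm, czw] at o5
  rw [czz] at o6
  rw [c11] at o7
  have lz := hN.memLp z
  have l1 := hm2.integrable_mul lz
  have l2 := hu2.integrable_mul lz
  have l3 := hu.integrable_mul (hN.memLp z')
  have l4 := (hN.memLp ξ).integrable_mul lz
  have l5 := (hN.memLp (Finsupp.single (.dist n) 1)).integrable_mul lz
  have l6 := lz.integrable_mul lz
  have l7 := (hN.memLp i₁).integrable_mul (hN.memLp i₁)
  have l8 := hx'.integrable_sq
  have l9 := hu.integrable_sq
  have lhs : ∫ ω, (2 * r * a * (prediction a f₁ f₂ N σ₀ σ₁ σ₂ n ω * noiseComb N z ω)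
      + 2 * r * (inputVar₂ a f₁ f₂ N n ω * noiseComb N z ω)
      + 2 * r * (inputVar₁ a f₁ f₂ N n ω * noiseComb N z' ω)
      + 2 * r * a * (noiseComb N ξ ω * noiseComb N z ω)
      + 2 * r * (noiseComb N (Finsupp.single (.dist n) 1) ω * noiseComb N z ω)) ∂P
      = 2 * r * a * e := by
    rw [integral_add, integral_add, integral_add, integral_add]
    · simp only [integral_const_mul, o1, o2, o3, o4, o5]
      ring
    · exact l1.const_mul _
    · exact l2.const_mul _
    · exact (l1.const_mul _).add (l2.const_mul _)
    · exact l3.const_mul _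
    · exact ((l1.const_mul _).add (l2.const_mul _)).add (l3.const_mul _)
    · exact l4.const_mul _
    · exact (((l1.const_mul _).add (l2.const_mul _)).add (l3.const_mul _)).add (l4.const_mul _)
    · exact l5.const_mul _
  have rhs : ∫ ω, (stateVar a f₁ f₂ N (n + 1) ω ^ 2
      + r ^ 2 * (noiseComb N z ω * noiseComb N z ω) + t * inputVar₁ a f₁ f₂ N n ω ^ 2
      + r ^ 2 * κ ^ 2 / t * (noiseComb N i₁ ω * noiseComb N i₁ ω)) ∂P
      = ∫ ω, stateVar a f₁ f₂ N (n + 1) ω ^ 2 ∂P + r ^ 2 * e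
        + t * ∫ ω, inputVar₁ a f₁ f₂ N n ω ^ 2 ∂P
        + r ^ 2 * e ^ 2 / (t * (p + σ₁ ^ 2)) := by
    rw [integral_add, integral_add, integral_add]
    · simp only [integral_const_mul, o6, o7, hκ]
      field_simp
    · exact l8
    · exact l6.const_mul _
    · exact l8.add (l6.const_mul _)
    · exact l9.const_mul _
    · exact (l8.add (l6.const_mul _)).add (l9.const_mul _)
    · exact l7.const_mul _
  rw [← lhs, ← rhs]
  refine integral_mono
    (((((l1.const_mul _).add (l2.const_mul _)).add (l3.const_mul _)).add
        (l4.const_mul _)).add (l5.const_mul _))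
    (((l8.add (l6.const_mul _)).add (l9.const_mul _)).add (l7.const_mul _)) fun ω => ?_
  have ex : stateVar a f₁ f₂ N (n + 1) ω = a * (prediction a f₁ f₂ N σ₀ σ₁ σ₂ n ω
      + noiseComb N ξ ω) + inputVar₁ a f₁ f₂ N n ω + inputVar₂ a f₁ f₂ N n ω
      + noiseComb N (Finsupp.single (.dist n) 1) ω := by
    simp only [stateVar_succ, noiseComb_single, prediction, hξ]; ring
  have ez' : noiseComb N z' ω = noiseComb N z ω - κ * noiseComb N i₁ ω := by
    simp only [hz', noiseComb_sub, noiseComb_smul]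
  have y1 := sq_nonneg (stateVar a f₁ f₂ N (n + 1) ω - r * noiseComb N z ω)
  have y2 : -(2 * r * κ * (inputVar₁ a f₁ f₂ N n ω * noiseComb N i₁ ω)) ≤
      t * inputVar₁ a f₁ f₂ N n ω ^ 2
        + r ^ 2 * κ ^ 2 / t * (noiseComb N i₁ ω * noiseComb N i₁ ω) := by
    have : 0 ≤ (t * inputVar₁ a f₁ f₂ N n ω + r * κ * noiseComb N i₁ ω) ^ 2 / t := by positivity
    have e : (t * inputVar₁ a f₁ f₂ N n ω + r * κ * noiseComb N i₁ ω) ^ 2 / t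
      = t * inputVar₁ a f₁ f₂ N n ω ^ 2
        + r ^ 2 * κ ^ 2 / t * (noiseComb N i₁ ω * noiseComb N i₁ ω)
        + 2 * r * κ * (inputVar₁ a f₁ f₂ N n ω * noiseComb N i₁ ω) := by
      field_simp
      ring
    linarith
  have y3 : 2 * r * a * (prediction a f₁ f₂ N σ₀ σ₁ σ₂ n ω * noiseComb N z ω)
      + 2 * r * (inputVar₂ a f₁ f₂ N n ω * noiseComb N z ω)
      + 2 * r * (inputVar₁ a f₁ f₂ N n ω * noiseComb N z' ω)
      + 2 * r * a * (noiseComb N ξ ω * noiseComb N z ω)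
      + 2 * r * (noiseComb N (Finsupp.single (.dist n) 1) ω * noiseComb N z ω)
      = 2 * r * stateVar a f₁ f₂ N (n + 1) ω * noiseComb N z ω
        - 2 * r * κ * (inputVar₁ a f₁ f₂ N n ω * noiseComb N i₁ ω) := by
    rw [ex, ez']; ring
  simp only
  linarith

/-- Unless the first controller spends power of order `a ^ 2 * T`, the next state has second
moment of order `a ^ 2 * σ₂ ^ 2`. -/
theorem le_integral_sq_succ (hN : IsIndepGaussian N (noiseVar σ₀ σ₁ σ₂) P) (h : σ₁ ≤ σ₂)
    {n : ℕ} {T : ℝ} (hT : 0 < T) (hσT : (σ₂ : ℝ) ^ 2 ≤ T)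
    (hp : 2 / 5 * T ≤ errorVar a σ₀ σ₁ σ₂ n)
    (hx : MemLp (stateVar a f₁ f₂ N n) 2 P) (hx' : MemLp (stateVar a f₁ f₂ N (n + 1)) 2 P)
    (hu : MemLp (inputVar₁ a f₁ f₂ N n) 2 P) :
    20 / 77 * (a ^ 2 * (σ₂ : ℝ) ^ 2) ≤ ∫ ω, stateVar a f₁ f₂ N (n + 1) ω ^ 2 ∂P
      + 50 / 7 * ((σ₂ : ℝ) ^ 2 / T) * ∫ ω, inputVar₁ a f₁ f₂ N n ω ^ 2 ∂P := by
  set X := ∫ ω, stateVar a f₁ f₂ N (n + 1) ω ^ 2 ∂P with hX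
  set U := ∫ ω, inputVar₁ a f₁ f₂ N n ω ^ 2 ∂P with hU
  have hX0 : 0 ≤ X := integral_nonneg fun ω => sq_nonneg _
  have hU0 : 0 ≤ U := integral_nonneg fun ω => sq_nonneg _
  rcases eq_or_ne σ₂ 0 with hσ | hσ
  · simpa [hσ] using hX0
  have hs : 0 < (σ₂ : ℝ) ^ 2 := by positivity
  have hp0 : 0 < errorVar a σ₀ σ₁ σ₂ n := lt_of_lt_of_le (by positivity) hp
  set p := errorVar a σ₀ σ₁ σ₂ n with hpdef
  have hY := fun r t ht => young_residualVar₂_le hN h hp0 hx hx' hu r (t := t) ht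
  rw [← hX, ← hU, ← hpdef] at hY
  set e := residualVar₂ a σ₀ σ₁ σ₂ n with he
  have hed : e = p * σ₂ ^ 2 / (p + σ₂ ^ 2) := rfl
  have he0 : 0 < e := by rw [hed]; positivity
  have he2 : 2 / 7 * (σ₂ : ℝ) ^ 2 ≤ e := by
    rw [hed, le_div_iff₀ (by positivity)]
    nlinarith
  have h1 := hY (10 / 11 * a) (10 * e / p) (by positivity)
  have h2 : e ^ 2 / (10 * e / p * (p + (σ₁ : ℝ) ^ 2)) ≤ e / 10 := by
    rw [div_le_iff₀ (by positivity)]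
    have : e / 10 * (10 * e / p * (p + (σ₁ : ℝ) ^ 2)) = e ^ 2 + e ^ 2 * σ₁ ^ 2 / p := by
      field_simp
    rw [this]
    have : 0 ≤ e ^ 2 * (σ₁ : ℝ) ^ 2 / p := by positivity
    linarith
  have h3 : 10 / 11 * a ^ 2 * e ≤ X + 10 * e / p * U := by
    have h4 := mul_le_mul_of_nonneg_left h2 (sq_nonneg (10 / 11 * a))
    rw [← mul_div_assoc] at h4
    nlinarith
  -- rescale from `e` to `2 / 7 * σ₂ ^ 2`
  set ρ := 2 / 7 * (σ₂ : ℝ) ^ 2 / e with hρ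
  have hρ0 : 0 < ρ := by positivity
  have hρ1 : ρ ≤ 1 := (div_le_one he0).2 he2
  have h5 := mul_le_mul_of_nonneg_left h3 hρ0.le
  have e1 : ρ * (10 / 11 * a ^ 2 * e) = 20 / 77 * (a ^ 2 * (σ₂ : ℝ) ^ 2) := by
    rw [hρ]; field_simp; ring
  have e2 : ρ * (X + 10 * e / p * U) = ρ * X + 20 / 7 * ((σ₂ : ℝ) ^ 2 / p) * U := by
    rw [hρ]; field_simp; ring
  rw [e1, e2] at h5
  have h6 : ρ * X ≤ X := mul_le_of_le_one_left hX0 hρ1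
  have h7 : 20 / 7 * ((σ₂ : ℝ) ^ 2 / p) ≤ 50 / 7 * ((σ₂ : ℝ) ^ 2 / T) := by
    have : (σ₂ : ℝ) ^ 2 / p ≤ σ₂ ^ 2 / (2 / 5 * T) := by gcongr
    have e : (σ₂ : ℝ) ^ 2 / (2 / 5 * T) = 5 / 2 * (σ₂ ^ 2 / T) := by field_simp
    linarith
  have := mul_le_mul_of_nonneg_right h7 hU0
  linarith

/-- The unstable mode has to be compensated by the next state, by the inputs or by the
disturbance. The weights sum to one in reciprocals. -/
theorem sq_mul_integral_sq_le (hN : IsIndepGaussian N (noiseVar σ₀ σ₁ σ₂) P)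
    {n : ℕ} (hx : MemLp (stateVar a f₁ f₂ N n) 2 P)
    (hx' : MemLp (stateVar a f₁ f₂ N (n + 1)) 2 P) (hu : MemLp (inputVar₁ a f₁ f₂ N n) 2 P) :
    a ^ 2 * ∫ ω, stateVar a f₁ f₂ N n ω ^ 2 ∂P ≤
      5 / 2 * ∫ ω, stateVar a f₁ f₂ N (n + 1) ω ^ 2 ∂P
      + 25 / 2 * ∫ ω, inputVar₁ a f₁ f₂ N n ω ^ 2 ∂P
      + 25 / 3 * ∫ ω, inputVar₂ a f₁ f₂ N n ω ^ 2 ∂P + 5 / 2 := by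
  have hu2 := memLp_inputVar₂ hN hx hx' hu
  have hw : ∫ ω, N (.dist n) ω ^ 2 ∂P = 1 := by
    have := hN.integral_mul (Finsupp.single (.dist n) 1) (Finsupp.single (.dist n) 1)
    simp only [noiseComb_single, covForm_single_left, Finsupp.single_eq_same, noiseVar,
      NNReal.coe_one, ← pow_two, one_pow] at this
    exact this
  have l1 := hx.integrable_sq
  have l2 := hx'.integrable_sq
  have l3 := hu.integrable_sq
  have l4 := hu2.integrable_sq
  have l5 := (hN.memLp_noise (.dist n)).integrable_sq
  have rhs : ∫ ω, (5 / 2 * stateVar a f₁ f₂ N (n + 1) ω ^ 2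
      + 25 / 2 * inputVar₁ a f₁ f₂ N n ω ^ 2
      + 25 / 3 * inputVar₂ a f₁ f₂ N n ω ^ 2 + 5 / 2 * N (.dist n) ω ^ 2) ∂P
      = 5 / 2 * ∫ ω, stateVar a f₁ f₂ N (n + 1) ω ^ 2 ∂P
      + 25 / 2 * ∫ ω, inputVar₁ a f₁ f₂ N n ω ^ 2 ∂P
      + 25 / 3 * ∫ ω, inputVar₂ a f₁ f₂ N n ω ^ 2 ∂P + 5 / 2 := by
    rw [integral_add, integral_add, integral_add]
    · simp only [integral_const_mul, hw, mul_one]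
    · exact l2.const_mul _
    · exact l3.const_mul _
    · exact (l2.const_mul _).add (l3.const_mul _)
    · exact l4.const_mul _
    · exact ((l2.const_mul _).add (l3.const_mul _)).add (l4.const_mul _)
    · exact l5.const_mul _
  rw [← rhs, ← integral_const_mul]
  refine integral_mono (l1.const_mul _)
    ((((l2.const_mul _).add (l3.const_mul _)).add (l4.const_mul _)).add (l5.const_mul _))
    fun ω => ?_
  simp only
  set x := stateVar a f₁ f₂ N n ω
  set x' := stateVar a f₁ f₂ N (n + 1) ω with hx'def
  set u := inputVar₁ a f₁ f₂ N n ω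
  set v := inputVar₂ a f₁ f₂ N n ω
  set w := N (.dist n) ω
  have e : a * x = x' - u - v - w := by rw [hx'def, stateVar_succ]; ring
  have : a ^ 2 * x ^ 2 = (x' - u - v - w) ^ 2 := by rw [← e]; ring
  rw [this]
  nlinarith [sq_nonneg (x' + 5 * u), sq_nonneg (3 * x' + 10 * v), sq_nonneg (x' + w),
    sq_nonneg (3 * u - 2 * v), sq_nonneg (5 * u - w), sq_nonneg (10 * v - 3 * w)]

end SecondMoments

/-! ### Long-run averages -/

section Averages

/-- A finite average cost forces all stage costs to be finite and bounded along a subsequence. -/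
theorem ne_top_and_frequently_le_of_limsup_average_lt_top {X C : ℕ → ℝ≥0∞} {q : ℝ≥0} (hq : 0 < q)
    (hXC : ∀ n, q * X n ≤ C n)
    (hfin : limsup (fun N : ℕ => (∑ n ∈ Finset.range N, C n) / (N : ℝ≥0∞)) atTop < ⊤) :
    (∀ n, X n ≠ ⊤) ∧ ∃ K : ℝ≥0, ∃ᶠ N in atTop, X N ≤ K := by
  have hq0 : (q : ℝ≥0∞) ≠ 0 := by exact_mod_cast hq.ne'
  constructor
  · intro n hn
    have hC : C n = ⊤ := by
      have := hXC n
      rw [hn, ENNReal.mul_top hq0] at this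
      exact top_le_iff.1 this
    refine hfin.not_ge (le_limsup_of_frequently_le (Eventually.frequently ?_))
    filter_upwards [eventually_gt_atTop n] with N hN
    have : ∑ n ∈ Finset.range N, C n = ⊤ := ENNReal.sum_eq_top.2 ⟨n, Finset.mem_range.2 hN, hC⟩
    rw [this, ENNReal.top_div_of_ne_top (ENNReal.natCast_ne_top N)]
  · set A := limsup (fun N : ℕ => (∑ n ∈ Finset.range N, C n) / (N : ℝ≥0∞)) atTop with hA
    lift A to ℝ≥0 using hfin.ne with A'
    refine ⟨2 * (A' + 1) / q, ?_⟩
    by_contra hcon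
    rw [not_frequently] at hcon
    obtain ⟨N₁, hN₁⟩ := eventually_atTop.1 hcon
    have hle : ((A' + 1 : ℝ≥0) : ℝ≥0∞) ≤
        limsup (fun N : ℕ => (∑ n ∈ Finset.range N, C n) / (N : ℝ≥0∞)) atTop := by
      refine le_limsup_of_frequently_le (Eventually.frequently ?_)
      filter_upwards [eventually_ge_atTop (2 * N₁ + 1)] with N hN
      rw [ENNReal.le_div_iff_mul_le (Or.inl (by exact_mod_cast (by omega : N ≠ 0)))
        (Or.inl (ENNReal.natCast_ne_top N))]
      have hsub : Finset.Ico N₁ N ⊆ Finset.range N := by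
        intro n hn
        exact Finset.mem_range.2 (Finset.mem_Ico.1 hn).2
      calc ((A' + 1 : ℝ≥0) : ℝ≥0∞) * N
          ≤ ((N - N₁ : ℕ) : ℝ≥0∞) * ((2 * (A' + 1) : ℝ≥0) : ℝ≥0∞) := by
            have : (N : ℝ≥0) ≤ 2 * ((N - N₁ : ℕ) : ℝ≥0) := by exact_mod_cast (by omega)
            have h2 : (A' + 1) * (N : ℝ≥0) ≤ ((N - N₁ : ℕ) : ℝ≥0) * (2 * (A' + 1)) :=
              calc (A' + 1) * (N : ℝ≥0) ≤ (A' + 1) * (2 * ((N - N₁ : ℕ) : ℝ≥0)) := by gcongr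
                _ = _ := by ring
            exact_mod_cast h2
        _ = ∑ n ∈ Finset.Ico N₁ N, ((2 * (A' + 1) : ℝ≥0) : ℝ≥0∞) := by
            rw [Finset.sum_const, Nat.card_Ico, nsmul_eq_mul]
        _ ≤ ∑ n ∈ Finset.Ico N₁ N, C n := by
            refine Finset.sum_le_sum fun n hn => le_trans ?_ (hXC n)
            have h3 := (not_le.1 (hN₁ n (Finset.mem_Ico.1 hn).1)).le
            calc ((2 * (A' + 1) : ℝ≥0) : ℝ≥0∞)
                = q * ((2 * (A' + 1) / q : ℝ≥0) : ℝ≥0∞) := by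
                  rw [← ENNReal.coe_mul, mul_div_cancel₀ _ hq.ne']
              _ ≤ q * X n := by gcongr
        _ ≤ ∑ n ∈ Finset.range N, C n := Finset.sum_le_sum_of_subset hsub
    rw [← hA] at hle
    have : A' + 1 ≤ A' := by exact_mod_cast hle
    exact absurd this (not_le.2 (lt_add_one A'))

theorem limsup_average_le {C : ℕ → ℝ≥0∞} {J : ℝ≥0∞} (h0 : C 0 ≠ ⊤) (hC : ∀ n, C (n + 1) ≤ J) :
    limsup (fun N : ℕ => (∑ n ∈ Finset.range N, C n) / (N : ℝ≥0∞)) atTop ≤ J := by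
  have hlim0 : Tendsto (fun N : ℕ => C 0 / (N : ℝ≥0∞)) atTop (nhds 0) := by
    simpa using ENNReal.Tendsto.const_div ENNReal.tendsto_nat_nhds_top (Or.inr h0)
  have hlim : Tendsto (fun N : ℕ => C 0 / (N : ℝ≥0∞) + J) atTop (nhds (0 + J)) :=
    hlim0.add tendsto_const_nhds
  rw [zero_add] at hlim
  rw [← hlim.limsup_eq]
  refine limsup_le_limsup ?_
  filter_upwards [eventually_gt_atTop 0] with N hN
  obtain ⟨M, rfl⟩ : ∃ M, N = M + 1 := ⟨N - 1, by omega⟩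
  have hN0 : ((M + 1 : ℕ) : ℝ≥0∞) ≠ 0 := by exact_mod_cast (by omega : M + 1 ≠ 0)
  have hNt : ((M + 1 : ℕ) : ℝ≥0∞) ≠ ⊤ := ENNReal.natCast_ne_top _
  calc (∑ n ∈ Finset.range (M + 1), C n) / ((M + 1 : ℕ) : ℝ≥0∞)
      ≤ (C 0 + J * ((M + 1 : ℕ) : ℝ≥0∞)) / ((M + 1 : ℕ) : ℝ≥0∞) := by
        gcongr
        rw [Finset.sum_range_succ', add_comm]
        gcongr
        calc ∑ n ∈ Finset.range M, C (n + 1) ≤ ∑ _n ∈ Finset.range M, J :=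
              Finset.sum_le_sum fun n _ => hC n
          _ = J * (M : ℝ≥0∞) := by simp [mul_comm]
          _ ≤ J * ((M + 1 : ℕ) : ℝ≥0∞) := by gcongr; omega
    _ = C 0 / ((M + 1 : ℕ) : ℝ≥0∞) + J := by
        rw [ENNReal.add_div, ENNReal.mul_div_cancel_right hN0 hNt]

/-- The arithmetic core: over a long window either the first controller has power of order
`a ^ 2 * T`, or both the state and the second input are as large as when the second controller
zero-forces the state. Here `b` stands for `a ^ 2` and `s` for `σ₂ ^ 2`, the capital variables
are sums over the window, and `M` is its length. -/
theorem window_dichotomy {b T s M X U V : ℝ} (hb : 6.25 ≤ b) (hT : 1 ≤ T) (hs : 0 ≤ s)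
    (hM : 0 < M) (h1 : 0.99 * M ≤ X) (h2 : 0.99 * M * (2 / 5 * T) ≤ X)
    (h3 : 0.99 * M * (20 / 77 * (b * s)) ≤ X + M / 100 + 50 / 7 * (s / T) * U)
    (h4 : b * X ≤ 5 / 2 * (X + M / 100) + 25 / 2 * U + 25 / 3 * V + 5 / 2 * M)
    (hU : U < 0.002 * (b * T) * M) :
    0.19 * (b * s + 1) * M ≤ X ∧ 0.0025 * (b * (b * s + 1)) * M ≤ V := by
  have hT0 : 0 < T := by linarith
  have hb0 : 0 < b := by linarith
  have e1 : s / T * U ≤ 0.002 * (b * s) * M := by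
    calc s / T * U ≤ s / T * (0.002 * (b * T) * M) := by gcongr
      _ = 0.002 * (b * s) * M := by field_simp
  have e2 : 0.24 * (b * s) * M ≤ X := by nlinarith
  have e3 : 0.19 * (b * s + 1) * M ≤ X := by nlinarith
  refine ⟨e3, ?_⟩
  have hX : 0 ≤ X := by nlinarith
  have e4 : b * (T * M) ≤ b * (2.53 * X) :=
    mul_le_mul_of_nonneg_left (by nlinarith) hb0.le
  have e5 : 6.25 * X ≤ b * X := by gcongr
  have e6 : 0.015 * (b * X) ≤ V := by nlinarith
  have e7 : b * (0.19 * (b * s + 1) * M) ≤ b * X := by gcongr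
  nlinarith

theorem sum_dichotomy {a T s : ℝ} {X U V : ℕ → ℝ≥0∞} {n₀ N : ℕ} (ha : 6.25 ≤ a ^ 2) (hT : 1 ≤ T)
    (hs : 0 ≤ s) (hX : ∀ n, X n ≠ ⊤)
    (h1 : ∀ n ≥ n₀, ENNReal.ofReal 1 ≤ X n) (h2 : ∀ n ≥ n₀, ENNReal.ofReal (2 / 5 * T) ≤ X n)
    (h3 : ∀ n ≥ n₀, ENNReal.ofReal (20 / 77 * (a ^ 2 * s)) ≤
      X (n + 1) + ENNReal.ofReal (50 / 7 * (s / T)) * U n)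
    (h4 : ∀ n, ENNReal.ofReal (a ^ 2) * X n ≤ ENNReal.ofReal (5 / 2) * X (n + 1)
      + ENNReal.ofReal (25 / 2) * U n + ENNReal.ofReal (25 / 3) * V n + ENNReal.ofReal (5 / 2))
    (hN0 : 0 < N) (hN : 100 * n₀ ≤ N) (hXN : X N ≤ ENNReal.ofReal (N / 100)) :
    (ENNReal.ofReal (0.39 * T * N) ≤ ∑ n ∈ Finset.range N, X n ∧
      ENNReal.ofReal (0.002 * (a ^ 2 * T) * N) ≤ ∑ n ∈ Finset.range N, U n) ∨
    (ENNReal.ofReal (0.19 * (a ^ 2 * s + 1) * N) ≤ ∑ n ∈ Finset.range N, X n ∧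
      ENNReal.ofReal (0.0025 * (a ^ 2 * (a ^ 2 * s + 1)) * N) ≤ ∑ n ∈ Finset.range N, V n) := by
  have hNpos : (0 : ℝ) < N := by exact_mod_cast hN0
  have hNn : n₀ ≤ N := by omega
  have hNn' : 0.99 * (N : ℝ) ≤ ((N - n₀ : ℕ) : ℝ) := by
    have : (100 * n₀ : ℝ) ≤ N := by exact_mod_cast hN
    rw [Nat.cast_sub hNn]; linarith
  have hsub : Finset.Ico n₀ N ⊆ Finset.range N := by
    intro n hn
    exact Finset.mem_range.2 (Finset.mem_Ico.1 hn).2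
  have hconst : ∀ {c : ℝ}, 0 ≤ c →
      ENNReal.ofReal (0.99 * N * c) ≤ ∑ _n ∈ Finset.Ico n₀ N, ENNReal.ofReal c := by
    intro c hc
    rw [Finset.sum_const, Nat.card_Ico, nsmul_eq_mul, ← ENNReal.ofReal_natCast,
      ← ENNReal.ofReal_mul (Nat.cast_nonneg _)]
    exact ENNReal.ofReal_le_ofReal (by gcongr)
  have hshift : ∑ n ∈ Finset.range N, X (n + 1) ≤ ∑ n ∈ Finset.range N, X n + X N := by
    rw [← Finset.sum_range_succ, Finset.sum_range_succ' X N]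
    exact le_self_add
  have s1 : ENNReal.ofReal (0.99 * N * 1) ≤ ∑ n ∈ Finset.range N, X n :=
    ((hconst zero_le_one).trans (Finset.sum_le_sum fun n hn =>
      h1 n (Finset.mem_Ico.1 hn).1)).trans (Finset.sum_le_sum_of_subset hsub)
  have s2 : ENNReal.ofReal (0.99 * N * (2 / 5 * T)) ≤ ∑ n ∈ Finset.range N, X n :=
    ((hconst (by linarith)).trans (Finset.sum_le_sum fun n hn =>
      h2 n (Finset.mem_Ico.1 hn).1)).trans (Finset.sum_le_sum_of_subset hsub)
  have s3 : ENNReal.ofReal (0.99 * N * (20 / 77 * (a ^ 2 * s))) ≤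
      ∑ n ∈ Finset.range N, X n + ENNReal.ofReal (N / 100)
        + ENNReal.ofReal (50 / 7 * (s / T)) * ∑ n ∈ Finset.range N, U n := by
    calc ENNReal.ofReal (0.99 * N * (20 / 77 * (a ^ 2 * s)))
        ≤ ∑ n ∈ Finset.Ico n₀ N, (X (n + 1) + ENNReal.ofReal (50 / 7 * (s / T)) * U n) :=
          (hconst (by positivity)).trans (Finset.sum_le_sum fun n hn =>
            h3 n (Finset.mem_Ico.1 hn).1)
      _ ≤ ∑ n ∈ Finset.range N, (X (n + 1) + ENNReal.ofReal (50 / 7 * (s / T)) * U n) :=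
          Finset.sum_le_sum_of_subset hsub
      _ ≤ _ := by
          rw [Finset.sum_add_distrib, ← Finset.mul_sum]
          gcongr
          exact hshift.trans (by gcongr)
  have s4 : ENNReal.ofReal (a ^ 2) * ∑ n ∈ Finset.range N, X n ≤
      ENNReal.ofReal (5 / 2) * (∑ n ∈ Finset.range N, X n + ENNReal.ofReal (N / 100))
        + ENNReal.ofReal (25 / 2) * ∑ n ∈ Finset.range N, U n
        + ENNReal.ofReal (25 / 3) * ∑ n ∈ Finset.range N, V n
        + ENNReal.ofReal (5 / 2 * N) := by
    rw [Finset.mul_sum]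
    refine (Finset.sum_le_sum fun n _ => h4 n).trans ?_
    rw [Finset.sum_add_distrib, Finset.sum_add_distrib, Finset.sum_add_distrib, Finset.sum_const,
      Finset.card_range, nsmul_eq_mul, ← Finset.mul_sum, ← Finset.mul_sum, ← Finset.mul_sum,
      mul_comm (N : ℝ≥0∞), ← ENNReal.ofReal_natCast, ← ENNReal.ofReal_mul (by norm_num)]
    gcongr
    exact hshift.trans (by gcongr)
  have hSX : ∑ n ∈ Finset.range N, X n ≠ ⊤ := ENNReal.sum_ne_top.2 fun n _ => hX n
  generalize (∑ n ∈ Finset.range N, X n) = SX at *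
  generalize (∑ n ∈ Finset.range N, U n) = SU at *
  generalize (∑ n ∈ Finset.range N, V n) = SV at *
  rcases le_or_gt (ENNReal.ofReal (0.002 * (a ^ 2 * T) * N)) SU with hU | hU
  · exact Or.inl ⟨le_trans (ENNReal.ofReal_le_ofReal (by nlinarith)) s2, hU⟩
  right
  have hSU : SU ≠ ⊤ := (hU.trans ENNReal.ofReal_lt_top).ne
  obtain ⟨x, hx, rfl⟩ : ∃ x : ℝ, 0 ≤ x ∧ SX = ENNReal.ofReal x :=
    ⟨SX.toReal, ENNReal.toReal_nonneg, (ENNReal.ofReal_toReal hSX).symm⟩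
  obtain ⟨u, hu, rfl⟩ : ∃ x : ℝ, 0 ≤ x ∧ SU = ENNReal.ofReal x :=
    ⟨SU.toReal, ENNReal.toReal_nonneg, (ENNReal.ofReal_toReal hSU).symm⟩
  have hst : 0 ≤ 50 / 7 * (s / T) := by positivity
  rw [ENNReal.ofReal_le_ofReal_iff hx] at s1 s2
  rw [← ENNReal.ofReal_add hx (by positivity), ← ENNReal.ofReal_mul hst,
    ← ENNReal.ofReal_add (by positivity) (by positivity),
    ENNReal.ofReal_le_ofReal_iff (by positivity)] at s3
  have hU' := (ENNReal.ofReal_lt_ofReal_iff_of_nonneg hu).1 hU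
  -- when `SV = ⊤` its bound is trivial, and any large enough `v` yields the bound on `x`
  obtain ⟨v, hv, hvSV, s4'⟩ : ∃ v : ℝ, 0 ≤ v ∧ (SV ≠ ⊤ → ENNReal.ofReal v = SV) ∧
      a ^ 2 * x ≤ 5 / 2 * (x + N / 100) + 25 / 2 * u + 25 / 3 * v + 5 / 2 * N := by
    by_cases hSV : SV = ⊤
    · refine ⟨a ^ 2 * x, by positivity, fun h => absurd hSV h, ?_⟩
      have : 0 ≤ a ^ 2 * x := by positivity
      have : (0 : ℝ) ≤ 5 / 2 * (x + N / 100) + 25 / 2 * u + 5 / 2 * N := by positivity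
      linarith
    · refine ⟨SV.toReal, ENNReal.toReal_nonneg, fun _ => ENNReal.ofReal_toReal hSV, ?_⟩
      rw [← ENNReal.ofReal_toReal hSV] at s4
      have hv : 0 ≤ SV.toReal := ENNReal.toReal_nonneg
      rwa [← ENNReal.ofReal_add hx (by positivity), ← ENNReal.ofReal_mul (by positivity),
        ← ENNReal.ofReal_mul (by positivity), ← ENNReal.ofReal_mul (by positivity),
        ← ENNReal.ofReal_mul (by positivity),
        ← ENNReal.ofReal_add (by positivity) (by positivity),
        ← ENNReal.ofReal_add (by positivity) (by positivity),
        ← ENNReal.ofReal_add (by positivity) (by positivity),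
        ENNReal.ofReal_le_ofReal_iff (by positivity)] at s4
  obtain ⟨c1, c2⟩ := window_dichotomy ha hT hs hNpos (by linarith) s2 s3 s4' hU'
  refine ⟨ENNReal.ofReal_le_ofReal c1, ?_⟩
  by_cases hSV : SV = ⊤
  · rw [hSV]; exact le_top
  · rw [← hvSV hSV]; exact ENNReal.ofReal_le_ofReal c2

end Averages

/-! ### Costs of zero-forcing and the converse bound -/

section Cost

theorem memLp_two_of_lintegral_sq_ne_top {Ω : Type*} [MeasurableSpace Ω] {P : Measure Ω}
    {f : Ω → ℝ} (hf : AEMeasurable f P) (h : ∫⁻ ω, ENNReal.ofReal (f ω ^ 2) ∂P ≠ ⊤) :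
    MemLp f 2 P := by
  rw [memLp_two_iff_integrable_sq hf.aestronglyMeasurable]
  exact (lintegral_ofReal_ne_top_iff_integrable (hf.pow_const 2).aestronglyMeasurable
    (ae_of_all _ fun ω => sq_nonneg _)).1 h

theorem lintegral_sq_eq_ofReal_integral {Ω : Type*} [MeasurableSpace Ω] {P : Measure Ω}
    {f : Ω → ℝ} (hf : MemLp f 2 P) :
    ∫⁻ ω, ENNReal.ofReal (f ω ^ 2) ∂P = ENNReal.ofReal (∫ ω, f ω ^ 2 ∂P) :=
  (ofReal_integral_eq_lintegral_ofReal hf.integrable_sq (ae_of_all _ fun _ => sq_nonneg _)).symm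

variable {Ω : Type*} [MeasurableSpace Ω] {P : Measure Ω} {σ₀ σ₁ σ₂ : ℝ≥0}

theorem IsIndepGaussian.lintegral_sq {ι : Type*} {N : ι → Ω → ℝ} {s : ι → ℝ≥0}
    (hN : IsIndepGaussian N s P) (c : ι →₀ ℝ) :
    ∫⁻ ω, ENNReal.ofReal (noiseComb N c ω ^ 2) ∂P = ENNReal.ofReal (covForm s c c) := by
  rw [lintegral_sq_eq_ofReal_integral (hN.memLp c), ← hN.integral_mul c c]
  simp only [pow_two]

theorem lintegral_stageCost {x0 : Ω → ℝ} {w v₁ v₂ : ℕ → Ω → ℝ}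
    (hN : ∀ i, AEMeasurable (noiseFamily x0 w v₁ v₂ i) P) (a : ℝ) (q r₁ r₂ : ℝ≥0)
    (f₁ f₂ : Controller) (n : ℕ) :
    ∫⁻ ω, ENNReal.ofReal (stageCost a q r₁ r₂ f₁ f₂ (x0 ω) (fun k => w k ω) (fun k => v₁ k ω)
        (fun k => v₂ k ω) n) ∂P =
      q * ∫⁻ ω, ENNReal.ofReal (stateVar a f₁ f₂ (noiseFamily x0 w v₁ v₂) n ω ^ 2) ∂P
      + r₁ * ∫⁻ ω, ENNReal.ofReal (inputVar₁ a f₁ f₂ (noiseFamily x0 w v₁ v₂) n ω ^ 2) ∂P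
      + r₂ * ∫⁻ ω, ENNReal.ofReal (inputVar₂ a f₁ f₂ (noiseFamily x0 w v₁ v₂) n ω ^ 2) ∂P := by
  have m0 := ((aemeasurable_stateVar (a := a) (f₁ := f₁) (f₂ := f₂) hN n).pow_const
    2).ennreal_ofReal
  have m1 := ((aemeasurable_inputVar₁ (a := a) (f₁ := f₁) (f₂ := f₂) hN n).pow_const
    2).ennreal_ofReal
  have m2 := ((aemeasurable_inputVar₂ (a := a) (f₁ := f₁) (f₂ := f₂) hN n).pow_const
    2).ennreal_ofReal
  rw [← lintegral_const_mul'' _ m0, ← lintegral_const_mul'' _ m1, ← lintegral_const_mul'' _ m2,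
    ← lintegral_add_left' (m0.const_mul _), ← lintegral_add_right' _ (m2.const_mul _)]
  refine lintegral_congr fun ω => ?_
  have e : stageCost a q r₁ r₂ f₁ f₂ (x0 ω) (fun k => w k ω) (fun k => v₁ k ω)
        (fun k => v₂ k ω) n =
      q * stateVar a f₁ f₂ (noiseFamily x0 w v₁ v₂) n ω ^ 2
      + r₁ * inputVar₁ a f₁ f₂ (noiseFamily x0 w v₁ v₂) n ω ^ 2
      + r₂ * inputVar₂ a f₁ f₂ (noiseFamily x0 w v₁ v₂) n ω ^ 2 := rfl
  rw [e, ENNReal.ofReal_add (by positivity) (by positivity),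
    ENNReal.ofReal_add (by positivity) (by positivity), ENNReal.ofReal_mul (NNReal.coe_nonneg _),
    ENNReal.ofReal_mul (NNReal.coe_nonneg _), ENNReal.ofReal_mul (NNReal.coe_nonneg _)]
  simp only [ENNReal.ofReal_coe_nnreal]

/-- The stationary cost `q 𝔼[x²] + r 𝔼[u²]` of the loop in which one controller, with
observation noise `σ` and input weight `r`, zero-forces the state. -/
noncomputable def zeroForcingCost (a : ℝ) (q r σ : ℝ≥0) : ℝ :=
  q * (a ^ 2 * σ ^ 2 + 1) + r * (a ^ 2 * (a ^ 2 * σ ^ 2 + 1 + σ ^ 2))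

theorem zeroForcingCost_pos (a : ℝ) {q : ℝ≥0} (hq : 0 < q) (r σ : ℝ≥0) :
    0 < zeroForcingCost a q r σ := by
  have : (0 : ℝ) < q := hq
  unfold zeroForcingCost
  positivity

/-- The state coefficients when the controller that observes through the noises `obs`
zero-forces the state. -/
noncomputable def zeroForcingState (a : ℝ) (obs : ℕ → NoiseIndex) : ℕ → NoiseIndex →₀ ℝ
  | 0 => Finsupp.single .init 1
  | n + 1 => (-a) • Finsupp.single (obs n) 1 + Finsupp.single (.dist n) 1

/-- The average cost of a loop whose state and active input are those of zero-forcing with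
observation noises `obs` of standard deviation `σ`. -/
theorem limsup_zeroForcing_le {N : NoiseIndex → Ω → ℝ} {s : NoiseIndex → ℝ≥0}
    (hN : IsIndepGaussian N s P) (hdist : ∀ n, s (.dist n) = 1) {obs : ℕ → NoiseIndex} {σ : ℝ≥0}
    (hobs : ∀ n, s (obs n) = σ ^ 2) (hinj : Function.Injective obs)
    (hne : ∀ n m, obs n ≠ .dist m) (a : ℝ) (q r : ℝ≥0)
    {x u : ℕ → Ω → ℝ} (hx : ∀ n, x n = noiseComb N (zeroForcingState a obs n))
    (hu : ∀ n ω, u n ω = -a * (x n ω + N (obs n) ω)) :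
    limsup (fun M : ℕ => (∑ n ∈ Finset.range M, (q * ∫⁻ ω, ENNReal.ofReal (x n ω ^ 2) ∂P
      + r * ∫⁻ ω, ENNReal.ofReal (u n ω ^ 2) ∂P)) / (M : ℝ≥0∞)) atTop
      ≤ ENNReal.ofReal (zeroForcingCost a q r σ) := by
  have hu' : ∀ n, u n =
      noiseComb N ((-a) • (zeroForcingState a obs n + Finsupp.single (obs n) 1)) := by
    intro n
    ext ω
    rw [hu, hx, noiseComb_smul, noiseComb_add, noiseComb_single]
  simp only [hx, hu', hN.lintegral_sq]
  refine limsup_average_le (C := fun n => (q : ℝ≥0∞) * _ + (r : ℝ≥0∞) * _)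
    (ENNReal.add_ne_top.2 ⟨ENNReal.mul_ne_top ENNReal.coe_ne_top ENNReal.ofReal_ne_top,
      ENNReal.mul_ne_top ENNReal.coe_ne_top ENNReal.ofReal_ne_top⟩) fun n => le_of_eq ?_
  have hdo : ∀ m, (Finsupp.single (obs m) (1 : ℝ) : NoiseIndex →₀ ℝ) (.dist n) = 0 :=
    fun m => Finsupp.single_eq_of_ne (hne m n).symm
  have hod : ∀ m, (Finsupp.single (NoiseIndex.dist n) (1 : ℝ)) (obs m) = 0 :=
    fun m => Finsupp.single_eq_of_ne (hne m n)
  have ho1 : (Finsupp.single (obs n) (1 : ℝ)) (obs (n + 1)) = 0 :=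
    Finsupp.single_eq_of_ne (hinj.ne (by omega))
  have e1 : covForm s (zeroForcingState a obs (n + 1)) (zeroForcingState a obs (n + 1))
      = a ^ 2 * σ ^ 2 + 1 := by
    simp only [zeroForcingState, map_add, map_smul, LinearMap.add_apply, LinearMap.smul_apply,
      smul_eq_mul, covForm_single_left, hdo, hod, hdist, hobs, Finsupp.single_eq_same,
      NNReal.coe_pow, NNReal.coe_one]
    ring
  have e2 : covForm s (zeroForcingState a obs (n + 1) + Finsupp.single (obs (n + 1)) 1)
      (zeroForcingState a obs (n + 1) + Finsupp.single (obs (n + 1)) 1)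
      = a ^ 2 * σ ^ 2 + 1 + σ ^ 2 := by
    simp only [map_add, LinearMap.add_apply, e1, covForm_single_right, covForm_single_left]
    simp only [zeroForcingState, Finsupp.add_apply, Finsupp.smul_apply, smul_eq_mul, ho1, hod,
      hobs, Finsupp.single_eq_same, NNReal.coe_pow]
    ring
  simp only [map_smul, LinearMap.smul_apply, smul_eq_mul, e1, e2]
  have h1 : 0 ≤ (q : ℝ) * (a ^ 2 * σ ^ 2 + 1) := by positivity
  have h2 : 0 ≤ (r : ℝ) * (a ^ 2 * (a ^ 2 * σ ^ 2 + 1 + σ ^ 2)) := by positivity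
  rw [zeroForcingCost, ENNReal.ofReal_add h1 h2, ENNReal.ofReal_mul (NNReal.coe_nonneg q),
    ENNReal.ofReal_mul (NNReal.coe_nonneg r),
    ENNReal.ofReal_coe_nnreal, ENNReal.ofReal_coe_nnreal]
  congr 3
  ring

variable {x0 : Ω → ℝ} {w v₁ v₂ : ℕ → Ω → ℝ}

theorem avgCost_zeroForcing₁_le (hG : IsGaussianNoise P σ₀ σ₁ σ₂ x0 w v₁ v₂) (a : ℝ)
    (q r₁ r₂ : ℝ≥0) :
    avgCost P x0 w v₁ v₂ a q r₁ r₂ (Controller.zeroForcing a) Controller.zero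
      ≤ ENNReal.ofReal (zeroForcingCost a q r₁ σ₁) := by
  have hN := hG.isIndepGaussian
  unfold avgCost
  simp only [lintegral_stageCost fun i => (hN.law i).aemeasurable]
  set N := noiseFamily x0 w v₁ v₂ with hNdef
  have hv : ∀ n ω, inputVar₂ a (Controller.zeroForcing a) Controller.zero N n ω = 0 :=
    fun _ _ => rfl
  have hu : ∀ n ω, inputVar₁ a (Controller.zeroForcing a) Controller.zero N n ω =
      -a * (stateVar a (Controller.zeroForcing a) Controller.zero N n ω + N (.obs₁ n) ω) :=
    fun _ _ => rfl
  simp only [hv, ne_eq, OfNat.ofNat_ne_zero, not_false_eq_true, zero_pow, ENNReal.ofReal_zero,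
    lintegral_zero, mul_zero, add_zero]
  refine limsup_zeroForcing_le hN (fun _ => rfl) (obs := NoiseIndex.obs₁) (fun _ => rfl)
    (fun _ _ h => NoiseIndex.obs₁.inj h) (by simp) a q r₁ ?_ hu
  intro n
  ext ω
  cases n with
  | zero =>
    rw [zeroForcingState, noiseComb_single]
    exact state_zero ..
  | succ n =>
    rw [stateVar_succ, hu, hv, zeroForcingState, noiseComb_add, noiseComb_smul, noiseComb_single,
      noiseComb_single]
    ring

theorem avgCost_zeroForcing₂_le (hG : IsGaussianNoise P σ₀ σ₁ σ₂ x0 w v₁ v₂) (a : ℝ)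
    (q r₁ r₂ : ℝ≥0) :
    avgCost P x0 w v₁ v₂ a q r₁ r₂ Controller.zero (Controller.zeroForcing a)
      ≤ ENNReal.ofReal (zeroForcingCost a q r₂ σ₂) := by
  have hN := hG.isIndepGaussian
  unfold avgCost
  simp only [lintegral_stageCost fun i => (hN.law i).aemeasurable]
  set N := noiseFamily x0 w v₁ v₂ with hNdef
  have hv : ∀ n ω, inputVar₁ a Controller.zero (Controller.zeroForcing a) N n ω = 0 :=
    fun _ _ => rfl
  have hu : ∀ n ω, inputVar₂ a Controller.zero (Controller.zeroForcing a) N n ω =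
      -a * (stateVar a Controller.zero (Controller.zeroForcing a) N n ω + N (.obs₂ n) ω) :=
    fun _ _ => rfl
  simp only [hv, ne_eq, OfNat.ofNat_ne_zero, not_false_eq_true, zero_pow, ENNReal.ofReal_zero,
    lintegral_zero, mul_zero, add_zero]
  refine limsup_zeroForcing_le hN (fun _ => rfl) (obs := NoiseIndex.obs₂) (fun _ => rfl)
    (fun _ _ h => NoiseIndex.obs₂.inj h) (by simp) a q r₂ ?_ hu
  intro n
  ext ω
  cases n with
  | zero =>
    rw [zeroForcingState, noiseComb_single]
    exact state_zero ..
  | succ n =>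
    rw [stateVar_succ, hu, hv, zeroForcingState, noiseComb_add, noiseComb_smul, noiseComb_single,
      noiseComb_single]
    ring

theorem linCost_le (hG : IsGaussianNoise P σ₀ σ₁ σ₂ x0 w v₁ v₂) (a : ℝ) (q r₁ r₂ : ℝ≥0) :
    linCost P x0 w v₁ v₂ a q r₁ r₂ ≤
      ENNReal.ofReal (min (zeroForcingCost a q r₁ σ₁) (zeroForcingCost a q r₂ σ₂)) := by
  rcases min_choice (zeroForcingCost a q r₁ σ₁) (zeroForcingCost a q r₂ σ₂) with h | h <;> rw [h]
  · exact (iInf₂_le (Controller.zeroForcing a, Controller.zero) (by simp [linBB])).trans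
      (avgCost_zeroForcing₁_le hG a q r₁ r₂)
  · exact (iInf₂_le (Controller.zero, Controller.zeroForcing a) (by simp [linBB])).trans
      (avgCost_zeroForcing₂_le hG a q r₁ r₂)

theorem optCost_le_linCost (a : ℝ) (q r₁ r₂ : ℝ≥0) :
    optCost P x0 w v₁ v₂ a q r₁ r₂ ≤ linCost P x0 w v₁ v₂ a q r₁ r₂ :=
  le_iInf₂ fun f _ => iInf_le _ f

/-- The converse bound: no pair of control laws beats the better zero-forcing loop by more than
the factor `1200`. -/
theorem le_avgCost (hG : IsGaussianNoise P σ₀ σ₁ σ₂ x0 w v₁ v₂) (h : σ₁ ≤ σ₂) {a : ℝ}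
    (ha : 2.5 ≤ |a|) (hσ : (σ₂ : ℝ) ^ 2 ≤ max 1 (a ^ 2 * (σ₁ : ℝ) ^ 2)) {q : ℝ≥0} (hq : 0 < q)
    (r₁ r₂ : ℝ≥0) (f₁ f₂ : Controller) :
    ENNReal.ofReal (min (zeroForcingCost a q r₁ σ₁) (zeroForcingCost a q r₂ σ₂) / 1200)
      ≤ avgCost P x0 w v₁ v₂ a q r₁ r₂ f₁ f₂ := by
  have hN := hG.isIndepGaussian
  have hNm := fun i => (hN.law i).aemeasurable
  have ha2 : 6.25 ≤ a ^ 2 := by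
    rw [← sq_abs]; nlinarith
  obtain ⟨n₀, hn₀⟩ := eventually_le_errorVar σ₀ h ha
  unfold avgCost
  simp only [lintegral_stageCost hNm]
  set N := noiseFamily x0 w v₁ v₂ with hNdef
  set T := max 1 (a ^ 2 * (σ₁ : ℝ) ^ 2) with hT
  have hT1 : 1 ≤ T := le_max_left _ _
  have hTσ : a ^ 2 * (σ₁ : ℝ) ^ 2 ≤ T := le_max_right _ _
  set X : ℕ → ℝ≥0∞ := fun n => ∫⁻ ω, ENNReal.ofReal (stateVar a f₁ f₂ N n ω ^ 2) ∂P with hX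
  set U : ℕ → ℝ≥0∞ := fun n => ∫⁻ ω, ENNReal.ofReal (inputVar₁ a f₁ f₂ N n ω ^ 2) ∂P with hU
  set V : ℕ → ℝ≥0∞ := fun n => ∫⁻ ω, ENNReal.ofReal (inputVar₂ a f₁ f₂ N n ω ^ 2) ∂P with hV
  change _ ≤ limsup (fun M : ℕ => (∑ n ∈ Finset.range M, (q * X n + r₁ * U n + r₂ * V n)) /
    (M : ℝ≥0∞)) atTop
  rcases eq_or_ne (limsup (fun M : ℕ => (∑ n ∈ Finset.range M, (q * X n + r₁ * U n + r₂ * V n)) /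
    (M : ℝ≥0∞)) atTop) ⊤ with htop | htop
  · rw [htop]; exact le_top
  obtain ⟨hXfin, K, hK⟩ := ne_top_and_frequently_le_of_limsup_average_lt_top hq
    (C := fun n => q * X n + r₁ * U n + r₂ * V n)
    (fun n => le_self_add.trans le_self_add) htop.lt_top
  have hxL : ∀ n, MemLp (stateVar a f₁ f₂ N n) 2 P := fun n =>
    memLp_two_of_lintegral_sq_ne_top (aemeasurable_stateVar hNm n) (hXfin n)
  have hXeq : ∀ n, X n = ENNReal.ofReal (∫ ω, stateVar a f₁ f₂ N n ω ^ 2 ∂P) := fun n =>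
    lintegral_sq_eq_ofReal_integral (hxL n)
  have huL : ∀ n, U n ≠ ⊤ → MemLp (inputVar₁ a f₁ f₂ N n) 2 P := fun n hn =>
    memLp_two_of_lintegral_sq_ne_top (aemeasurable_inputVar₁ hNm n) hn
  have h1 : ∀ n ≥ n₀, ENNReal.ofReal 1 ≤ X n := fun n hn => by
    rw [hXeq]
    exact ENNReal.ofReal_le_ofReal ((hn₀ n hn).1.trans (errorVar_le_integral_sq hN h (hxL n)))
  have h2 : ∀ n ≥ n₀, ENNReal.ofReal (2 / 5 * T) ≤ X n := fun n hn => by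
    rw [hXeq]
    exact ENNReal.ofReal_le_ofReal ((hn₀ n hn).2.trans (errorVar_le_integral_sq hN h (hxL n)))
  have hi0 : ∀ f : Ω → ℝ, 0 ≤ ∫ ω, f ω ^ 2 ∂P := fun f => integral_nonneg fun _ => sq_nonneg _
  have h3 : ∀ n ≥ n₀, ENNReal.ofReal (20 / 77 * (a ^ 2 * (σ₂ : ℝ) ^ 2)) ≤
      X (n + 1) + ENNReal.ofReal (50 / 7 * ((σ₂ : ℝ) ^ 2 / T)) * U n := by
    intro n hn
    by_cases hUn : U n = ⊤
    · rcases eq_or_ne σ₂ 0 with h0 | h0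
      · simp [h0]
      · have : 0 < 50 / 7 * ((σ₂ : ℝ) ^ 2 / T) := by positivity
        rw [hUn, ENNReal.mul_top (by simpa using this), add_top]
        exact le_top
    · have hu := huL n hUn
      have hUe : U n = ENNReal.ofReal (∫ ω, inputVar₁ a f₁ f₂ N n ω ^ 2 ∂P) :=
        lintegral_sq_eq_ofReal_integral hu
      rw [hXeq, hUe, ← ENNReal.ofReal_mul (by positivity), ← ENNReal.ofReal_add (hi0 _)
        (mul_nonneg (by positivity) (hi0 _))]
      exact ENNReal.ofReal_le_ofReal (le_integral_sq_succ hN h (by linarith) hσ (hn₀ n hn).2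
        (hxL n) (hxL _) hu)
  have h4 : ∀ n, ENNReal.ofReal (a ^ 2) * X n ≤ ENNReal.ofReal (5 / 2) * X (n + 1)
      + ENNReal.ofReal (25 / 2) * U n + ENNReal.ofReal (25 / 3) * V n
      + ENNReal.ofReal (5 / 2) := by
    intro n
    by_cases hUn : U n = ⊤
    · rw [hUn, ENNReal.mul_top (by norm_num)]
      simp
    · have hu := huL n hUn
      have hUe : U n = ENNReal.ofReal (∫ ω, inputVar₁ a f₁ f₂ N n ω ^ 2 ∂P) :=
        lintegral_sq_eq_ofReal_integral hu
      have hVe : V n = ENNReal.ofReal (∫ ω, inputVar₂ a f₁ f₂ N n ω ^ 2 ∂P) :=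
        lintegral_sq_eq_ofReal_integral (memLp_inputVar₂ hN (hxL n) (hxL _) hu)
      have p1 := hi0 (stateVar a f₁ f₂ N (n + 1))
      have p2 := hi0 (inputVar₁ a f₁ f₂ N n)
      have p3 := hi0 (inputVar₂ a f₁ f₂ N n)
      rw [hXeq, hXeq, hUe, hVe, ← ENNReal.ofReal_mul (by positivity),
        ← ENNReal.ofReal_mul (by positivity), ← ENNReal.ofReal_mul (by positivity),
        ← ENNReal.ofReal_mul (by positivity), ← ENNReal.ofReal_add (by positivity) (by positivity),
        ← ENNReal.ofReal_add (by positivity) (by positivity),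
        ← ENNReal.ofReal_add (by positivity) (by positivity)]
      exact ENNReal.ofReal_le_ofReal (sq_mul_integral_sq_le hN (hxL n) (hxL _) hu)
  -- times at which the window `[0, M)` is long and its boundary term negligible
  refine le_limsup_of_frequently_le ((hK.and_eventually (eventually_ge_atTop
    (100 * n₀ + ⌈100 * (K : ℝ)⌉₊ + 1))).mono ?_)
  rintro M ⟨hKM, hM⟩
  have hM0 : 0 < M := by omega
  have hMr : (0 : ℝ) < M := by exact_mod_cast hM0
  have hXM : X M ≤ ENNReal.ofReal (M / 100) := by
    refine hKM.trans ?_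
    rw [← ENNReal.ofReal_coe_nnreal]
    refine ENNReal.ofReal_le_ofReal ?_
    have h5 : ⌈100 * (K : ℝ)⌉₊ ≤ M := by omega
    have h6 : 100 * (K : ℝ) ≤ M := (Nat.le_ceil _).trans (by exact_mod_cast h5)
    linarith
  have hs : 0 ≤ (σ₂ : ℝ) ^ 2 := by positivity
  have hq0 : (0 : ℝ) ≤ q := q.2
  have hr1 : (0 : ℝ) ≤ r₁ := r₁.2
  have hr2 : (0 : ℝ) ≤ r₂ := r₂.2
  rw [ENNReal.le_div_iff_mul_le (Or.inl (by exact_mod_cast hM0.ne'))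
    (Or.inl (ENNReal.natCast_ne_top M)), ← ENNReal.ofReal_natCast, ← ENNReal.ofReal_mul' hMr.le,
    Finset.sum_add_distrib, Finset.sum_add_distrib, ← Finset.mul_sum, ← Finset.mul_sum,
    ← Finset.mul_sum]
  rcases sum_dichotomy ha2 hT1 hs hXfin h1 h2 h3 h4 hM0 (by omega) hXM with ⟨g1, g2⟩ | ⟨g1, g2⟩
  · calc ENNReal.ofReal (min (zeroForcingCost a q r₁ σ₁) (zeroForcingCost a q r₂ σ₂) / 1200 * M)
        ≤ ENNReal.ofReal (q * (0.39 * T * M) + r₁ * (0.002 * (a ^ 2 * T) * M)) := by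
          refine ENNReal.ofReal_le_ofReal ?_
          have hmin := min_le_left (zeroForcingCost a q r₁ σ₁) (zeroForcingCost a q r₂ σ₂)
          have k1 : a ^ 2 * (σ₁ : ℝ) ^ 2 + 1 ≤ 468 * T := by linarith
          have k2 : a ^ 2 * (σ₁ : ℝ) ^ 2 + 1 + (σ₁ : ℝ) ^ 2 ≤ 2.4 * T := by
            nlinarith [sq_nonneg (σ₁ : ℝ)]
          have k3 : zeroForcingCost a q r₁ σ₁ ≤ q * (468 * T) + r₁ * (a ^ 2 * (2.4 * T)) := by
            unfold zeroForcingCost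
            gcongr
          calc min (zeroForcingCost a q r₁ σ₁) (zeroForcingCost a q r₂ σ₂) / 1200 * M
              ≤ (q * (468 * T) + r₁ * (a ^ 2 * (2.4 * T))) / 1200 * M := by
                gcongr; exact hmin.trans k3
            _ = _ := by ring
      _ = q * ENNReal.ofReal (0.39 * T * M) + r₁ * ENNReal.ofReal (0.002 * (a ^ 2 * T) * M) := by
          rw [ENNReal.ofReal_add (by positivity) (by positivity), ENNReal.ofReal_mul hq0,
            ENNReal.ofReal_mul hr1, ENNReal.ofReal_coe_nnreal, ENNReal.ofReal_coe_nnreal]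
      _ ≤ _ := by
          refine le_trans ?_ le_self_add
          gcongr
  · calc ENNReal.ofReal (min (zeroForcingCost a q r₁ σ₁) (zeroForcingCost a q r₂ σ₂) / 1200 * M)
        ≤ ENNReal.ofReal (q * (0.19 * (a ^ 2 * (σ₂ : ℝ) ^ 2 + 1) * M)
            + r₂ * (0.0025 * (a ^ 2 * (a ^ 2 * (σ₂ : ℝ) ^ 2 + 1)) * M)) := by
          refine ENNReal.ofReal_le_ofReal ?_
          have hmin := min_le_right (zeroForcingCost a q r₁ σ₁) (zeroForcingCost a q r₂ σ₂)
          have k0 : 0 ≤ a ^ 2 * (σ₂ : ℝ) ^ 2 := by positivity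
          have k1 : a ^ 2 * (σ₂ : ℝ) ^ 2 + 1 ≤ 228 * (a ^ 2 * (σ₂ : ℝ) ^ 2 + 1) := by linarith
          have k2 : a ^ 2 * (σ₂ : ℝ) ^ 2 + 1 + (σ₂ : ℝ) ^ 2 ≤
              3 * (a ^ 2 * (σ₂ : ℝ) ^ 2 + 1) := by
            nlinarith
          have k3 : zeroForcingCost a q r₂ σ₂ ≤ q * (228 * (a ^ 2 * (σ₂ : ℝ) ^ 2 + 1))
              + r₂ * (a ^ 2 * (3 * (a ^ 2 * (σ₂ : ℝ) ^ 2 + 1))) := by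
            unfold zeroForcingCost
            gcongr
          calc min (zeroForcingCost a q r₁ σ₁) (zeroForcingCost a q r₂ σ₂) / 1200 * M
              ≤ (q * (228 * (a ^ 2 * (σ₂ : ℝ) ^ 2 + 1))
              + r₂ * (a ^ 2 * (3 * (a ^ 2 * (σ₂ : ℝ) ^ 2 + 1)))) / 1200 * M := by
                gcongr; exact hmin.trans k3
            _ = _ := by ring
      _ = q * ENNReal.ofReal (0.19 * (a ^ 2 * (σ₂ : ℝ) ^ 2 + 1) * M)
          + r₂ * ENNReal.ofReal (0.0025 * (a ^ 2 * (a ^ 2 * (σ₂ : ℝ) ^ 2 + 1)) * M) := by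
          rw [ENNReal.ofReal_add (by positivity) (by positivity), ENNReal.ofReal_mul hq0,
            ENNReal.ofReal_mul hr2, ENNReal.ofReal_coe_nnreal, ENNReal.ofReal_coe_nnreal]
      _ ≤ _ := by
          gcongr
          exact le_self_add.trans' (by gcongr)

end Cost

theorem proposition5 :
    ∃ c : ℝ≥0, c ≤ 1200 ∧
      ∀ (Ω : Type*) [MeasurableSpace Ω] (P : Measure Ω) [IsProbabilityMeasure P]
        (a : ℝ) (q r₁ r₂ σ₀ σ₁ σ₂ : ℝ≥0) (x0 : Ω → ℝ) (w v₁ v₂ : ℕ → Ω → ℝ),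
        IsGaussianNoise P σ₀ σ₁ σ₂ x0 w v₁ v₂ →
        0 < q → σ₁ ≤ σ₂ →
        2.5 ≤ |a| → (σ₂ : ℝ) ^ 2 ≤ max 1 (a ^ 2 * (σ₁ : ℝ) ^ 2) →
        0 < optCost P x0 w v₁ v₂ a q r₁ r₂ ∧
          optCost P x0 w v₁ v₂ a q r₁ r₂ < ⊤ ∧
          linCost P x0 w v₁ v₂ a q r₁ r₂ / optCost P x0 w v₁ v₂ a q r₁ r₂ ≤ (c : ℝ≥0∞) := by
  refine ⟨1200, le_rfl, ?_⟩
  intro Ω _ P _ a q r₁ r₂ σ₀ σ₁ σ₂ x0 w v₁ v₂ hG hq h ha hσ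
  set J := min (zeroForcingCost a q r₁ σ₁) (zeroForcingCost a q r₂ σ₂) with hJ
  have hJ0 : 0 < J := lt_min (zeroForcingCost_pos a hq _ _) (zeroForcingCost_pos a hq _ _)
  have hlow : ENNReal.ofReal (J / 1200) ≤ optCost P x0 w v₁ v₂ a q r₁ r₂ :=
    le_iInf fun f => le_avgCost hG h ha hσ hq r₁ r₂ f.1 f.2
  have hup := linCost_le hG a q r₁ r₂
  refine ⟨lt_of_lt_of_le (ENNReal.ofReal_pos.2 (by positivity)) hlow,
    lt_of_le_of_lt ((optCost_le_linCost a q r₁ r₂).trans hup) ENNReal.ofReal_lt_top,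
    ENNReal.div_le_of_le_mul (hup.trans ?_)⟩
  calc ENNReal.ofReal J = ((1200 : ℝ≥0) : ℝ≥0∞) * ENNReal.ofReal (J / 1200) := by
        rw [← ENNReal.ofReal_coe_nnreal, ← ENNReal.ofReal_mul (NNReal.coe_nonneg _)]
        congr 1
        simp only [NNReal.coe_ofNat]
        ring
    _ ≤ _ := by gcongr
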